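/- Let $m\ge 0$ and $n\ge m+1$. Let $M$ be a closed topological $m$-manifold (a compact Hausdorff space locally homeomorphic to $\mathbf{R}^m$, not assumed connected, orientable or smooth), and let $\phi\colon M\to M$ be a homeomorphism without fixed points such that $\phi\circ\phi=\mathrm{id}_M$; write $p^*:=\phi(p)$. Let $f\colon M\to\mathbf{R}^n$ be continuous and let $\lambda\subset\mathbf{R}^n\setminus f(M)$ be an affine subspace of dimension $n-m-1$. The mod 2 winding number $w_2(f,\lambda)$ is defined as follows. Let $\lambda'$ be an $(m+1)$-dimensional affine subspace orthogonal to $\lambda$, let $\pi\colon\mathbf{R}^n\to\lambda'$ be the orthogonal projection, and let $o$ be the single point of $\pi(\lambda)$. Then $r:=(\pi\circ f-o)/\|\pi\circ f-o\|$ is a continuous map from $M$ to the unit sphere $\mathbf{S}^m$ of the $(m+1)$-dimensional vector space $\lambda'-o$, and $w_2(f,\lambda):=\deg_2(r)\in\mathbf{Z}/2$. Here $\deg_2(r)$, the degree mod 2, is $1$ if $r_*[M]\ne 0$ in $H_m(\mathbf{S}^m;\mathbf{Z}/2)$ and $0$ otherwise, where $[M]\in H_m(M;\mathbf{Z}/2)$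 is the mod 2 fundamental class, i.e. the class whose image in $H_m(M,M\setminus\{x\};\mathbf{Z}/2)\cong\mathbf{Z}/2$ is nonzero for every $x\in M$. If $w_2(f,\lambda)\neq 0$, then there is a point $p\in M$ such that the antipodal chord of $f$ at $p$, i.e. the closed line segment with end points $f(p)$ and $f(p^*)$, intersects $\lambda$. -/

import Mathlib

open CategoryTheory

universe u

noncomputable section

namespace ModTwo

/-! ### Singular homology with coefficients in `ℤ/2` -/

/-- The coefficient group `ℤ/2`, lifted to the universe of the spaces under consideration. -/
abbrev coeff : ModuleCat.{u} (ZMod 2) := ModuleCat.of (ZMod 2) (ULift.{u} (ZMod 2))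

/-- The singular chain complex with coefficients in `ℤ/2`. -/
abbrev chains : TopCat.{u} ⥤ ChainComplex (ModuleCat.{u} (ZMod 2)) ℕ :=
  (AlgebraicTopology.singularChainComplexFunctor (ModuleCat.{u} (ZMod 2))).obj coeff

/-- The singular homology `H_k(X; ℤ/2)`. -/
abbrev homology (k : ℕ) (X : Type u) [TopologicalSpace X] : ModuleCat.{u} (ZMod 2) :=
  (chains.obj (TopCat.of X)).homology k

/-- The map `H_k(X; ℤ/2) → H_k(Y; ℤ/2)` induced by a continuous map. -/
def homologyMap (k : ℕ) {X Y : Type u} [TopologicalSpace X] [TopologicalSpace Y] (g : C(X, Y)) :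
    homology k X ⟶ homology k Y :=
  HomologicalComplex.homologyMap (chains.map (TopCat.ofHom g)) k

/-- The map of singular chain complexes `C(A) → C(X)` induced by the inclusion of a subspace. -/
abbrev chainsInclusion {X : Type u} [TopologicalSpace X] (A : Set X) :
    chains.obj (TopCat.of A) ⟶ chains.obj (TopCat.of X) :=
  chains.map (TopCat.ofHom ⟨Subtype.val, continuous_subtype_val⟩)

/-- The relative singular chain complex `C(X, A) = C(X) / C(A)`. -/
abbrev relativeChains {X : Type u} [TopologicalSpace X] (A : Set X) :
    ChainComplex (ModuleCat.{u} (ZMod 2)) ℕ :=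
  Limits.cokernel (chainsInclusion A)

/-- The relative singular homology `H_k(X, A; ℤ/2)`. -/
abbrev relativeHomology (k : ℕ) {X : Type u} [TopologicalSpace X] (A : Set X) :
    ModuleCat.{u} (ZMod 2) :=
  (relativeChains A).homology k

/-- The natural map `H_k(X; ℤ/2) → H_k(X, A; ℤ/2)`. -/
def toRelativeHomology (k : ℕ) {X : Type u} [TopologicalSpace X] (A : Set X) :
    homology k X ⟶ relativeHomology k A :=
  HomologicalComplex.homologyMap (Limits.cokernel.π (chainsInclusion A)) k

/-! ### Degree mod 2 -/

/-- `z` is the mod 2 fundamental class of the closed `m`-manifold `M`: for every point `x`, it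
restricts to the nonzero element of the local homology group `H_m(M, M ∖ {x}; ℤ/2) ≅ ℤ/2`.
Every closed `m`-manifold, connected or not, has exactly one such class. -/
def IsFundamentalClass (m : ℕ) {M : Type u} [TopologicalSpace M] (z : homology m M) : Prop :=
  ∀ x : M, toRelativeHomology m ({x}ᶜ : Set M) z ≠ 0

/-- A continuous map into a space `S` of the lowest universe, with its target lifted to the
universe of the source, so that both spaces have homology in the same category. -/
def liftTarget {M : Type u} {S : Type} [TopologicalSpace M] [TopologicalSpace S] (r : C(M, S)) :
    C(M, ULift.{u} S) :=
  ⟨fun p => ULift.up (r p), continuous_uliftUp.comp r.continuous⟩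

open scoped Classical in
/-- The degree mod 2 of a continuous map `r : M → S` from a closed `m`-manifold to an `m`-sphere:
it is `1` if `r` carries the mod 2 fundamental class of `M` to a nonzero element
of `H_m(S; ℤ/2)`, and `0` otherwise. -/
def degree (m : ℕ) {M : Type u} {S : Type} [TopologicalSpace M] [TopologicalSpace S]
    (r : C(M, S)) : ZMod 2 :=
  if ∃ z : homology m M, IsFundamentalClass m z ∧ homologyMap m (liftTarget r) z ≠ 0 then 1 else 0

/-! ### Winding number mod 2 about an affine subspace -/

section Winding

variable {n : ℕ} {M : Type u} [TopologicalSpace M]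

/-- The component of `x` orthogonal to the affine subspace `L`, that is `x - π_L(x)`, where `π_L` is
the orthogonal projection to `L`. If `L'` is an affine subspace orthogonal and complementary to `L`,
`π` is the orthogonal projection to `L'`, and `o` is the point of `π(L)`, this is `π(x) - o`; so the
vector space `L.directionᗮ` is `L'` with `o` as its origin. -/
def normalComponent (L : AffineSubspace ℝ (EuclideanSpace ℝ (Fin n))) [Nonempty L]
    (x : EuclideanSpace ℝ (Fin n)) : L.directionᗮ :=
  ⟨x -ᵥ (EuclideanGeometry.orthogonalProjection L x : EuclideanSpace ℝ (Fin n)),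
    EuclideanGeometry.vsub_orthogonalProjection_mem_direction_orthogonal L x⟩

theorem continuous_normalComponent (L : AffineSubspace ℝ (EuclideanSpace ℝ (Fin n)))
    [Nonempty L] : Continuous (normalComponent L) := by
  unfold normalComponent
  fun_prop

theorem normalComponent_ne_zero (L : AffineSubspace ℝ (EuclideanSpace ℝ (Fin n)))
    [Nonempty L] {x : EuclideanSpace ℝ (Fin n)} (hx : x ∉ L) : normalComponent L x ≠ 0 := by
  intro h
  apply hx
  rw [← EuclideanGeometry.orthogonalProjection_eq_self_iff]
  exact (vsub_eq_zero_iff_eq.mp (congrArg Subtype.val h)).symm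

/-- For `f : M → ℝⁿ` with image disjoint from `L`, the map `r = (π ∘ f - o) / ‖π ∘ f - o‖` from `M`
to the unit sphere of the orthogonal complement of `L`. -/
def radialMap (f : C(M, EuclideanSpace ℝ (Fin n)))
    (L : AffineSubspace ℝ (EuclideanSpace ℝ (Fin n))) [Nonempty L]
    (hf : ∀ p, f p ∉ L) : C(M, Metric.sphere (0 : L.directionᗮ) 1) where
  toFun p := ⟨‖normalComponent L (f p)‖⁻¹ • normalComponent L (f p), by
    rw [mem_sphere_zero_iff_norm]
    exact norm_smul_inv_norm (𝕜 := ℝ) (normalComponent_ne_zero L (hf p))⟩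
  continuous_toFun := by
    have h : Continuous fun p => normalComponent L (f p) :=
      (continuous_normalComponent L).comp f.continuous
    exact ((h.norm.inv₀ fun p => norm_ne_zero_iff.mpr
      (normalComponent_ne_zero L (hf p))).smul h).subtype_mk _

/-- The winding number mod 2, `w₂(f, L)`, of a continuous map `f` from a closed `m`-manifold
to `ℝⁿ` about an affine subspace `L` of dimension `n - m - 1` disjoint from the image of `f`. -/
def windingNumber (m : ℕ) (f : C(M, EuclideanSpace ℝ (Fin n)))
    (L : AffineSubspace ℝ (EuclideanSpace ℝ (Fin n))) [Nonempty L]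
    (hf : ∀ p, f p ∉ L) : ZMod 2 :=
  degree m (radialMap f L hf)

end Winding

end ModTwo

end

/-! Suppose that no antipodal chord meets `L`. Sliding each `f p` along its chord to the midpoint is
a homotopy that avoids `L`, so the radial map of `f` is homotopic to that of the midpoint map, which
takes equal values at `p` and `φ p`. It remains to see that a `φ`-invariant map `g` kills the mod 2
fundamental class (`exists_push_eq_bd`).

Such a `g` factors through the orbit space `N`, again a closed `m`-manifold, with projection `q`. At
a point of `N`, the local class of `q_*[M]` is the sum of the contributions of two sheets. Each is a
nonzero element of a local homology group with at most one nonzero element, so they cancel mod 2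
(`null_push_involutionMk`). A class of `H_m(N)` that vanishes locally at every point is zero
(`detected_univ`), so `q_*[M] = 0` and `g_*[M] = 0`.

Homology is handled on explicit mod 2 chains, where `Chain X (k + 1)` has degree `k`, through the
predicates `RelCycle` and `Null`. The tools are the prism operator, barycentric subdivision
(`exists_small`), and two exactness arguments from the relative Mayer-Vietoris sequence:
`Connects.null` computes the local homology of `ℝᵐ`, and `null_inter` glues detection over unions.
Only at the end are these chains compared with the singular chain complex. -/

noncomputable section

namespace SingularModTwo

/-! ### Chains of vertex tuples -/

section Tuples

variable {C D E : Type*}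

/-- Mod 2 chains of tuples of `k` points, with the empty tuple in augmentation degree `0`. -/
abbrev Tup (C : Type*) (k : ℕ) := (Fin k → C) →₀ ZMod 2

/-- The simplicial boundary. -/
def tupBd {k : ℕ} : Tup C (k + 1) →ₗ[ZMod 2] Tup C k :=
  Finsupp.linearCombination (ZMod 2) fun v => ∑ i : Fin (k + 1), Finsupp.single (v ∘ i.succAbove) 1

/-- The cone with apex `b`. -/
def cone (b : C) {k : ℕ} : Tup C k →ₗ[ZMod 2] Tup C (k + 1) :=
  Finsupp.lmapDomain _ _ (fun v : Fin k → C => (Fin.cons b v : Fin (k + 1) → C))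

/-- The map induced by a map of vertices. -/
def tupMap (f : C → D) {k : ℕ} : Tup C k →ₗ[ZMod 2] Tup D k :=
  Finsupp.lmapDomain _ _ (fun v : Fin k → C => f ∘ v)

theorem tupBd_single {k : ℕ} (v : Fin (k + 1) → C) :
    tupBd (Finsupp.single v 1) = ∑ i : Fin (k + 1), Finsupp.single (v ∘ i.succAbove) 1 := by
  simp [tupBd]

theorem cone_single (b : C) {k : ℕ} (v : Fin k → C) :
    cone b (Finsupp.single v 1) = Finsupp.single (Fin.cons b v : Fin (k + 1) → C) 1 := by
  simp [cone]

theorem tupMap_single (f : C → D) {k : ℕ} (v : Fin k → C) :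
    tupMap f (Finsupp.single v 1) = Finsupp.single (f ∘ v) 1 := by
  simp [tupMap]

theorem hom_ext_single {α V : Type*} [AddCommGroup V] [Module (ZMod 2) V]
    {f g : (α →₀ ZMod 2) →ₗ[ZMod 2] V}
    (h : ∀ a, f (Finsupp.single a 1) = g (Finsupp.single a 1)) : f = g :=
  Finsupp.lhom_ext' fun a => LinearMap.ext_ring (by simpa using h a)

theorem add_self_eq_zero {V : Type*} [AddCommGroup V] [Module (ZMod 2) V] (x : V) : x + x = 0 := by
  rw [← two_smul (ZMod 2) x, show (2 : ZMod 2) = 0 from rfl, zero_smul]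

theorem two_zsmul_eq_zero {V : Type*} [AddCommGroup V] [Module (ZMod 2) V] (x : V) :
    (2 : ℤ) • x = 0 := by
  rw [two_zsmul, add_self_eq_zero]

theorem neg_eq_self {V : Type*} [AddCommGroup V] [Module (ZMod 2) V] (x : V) : -x = x :=
  neg_eq_of_add_eq_zero_left (add_self_eq_zero x)

theorem eq_of_add_eq_zero {V : Type*} [AddCommGroup V] [Module (ZMod 2) V] {x y : V}
    (h : x + y = 0) : x = y := by
  rw [eq_neg_of_add_eq_zero_left h, neg_eq_self]

theorem tupBd_tupMap (f : C → D) {k : ℕ} (c : Tup C (k + 1)) :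
    tupBd (tupMap f c) = tupMap f (tupBd c) := by
  have : tupBd ∘ₗ tupMap f = tupMap f ∘ₗ tupBd (k := k) := by
    apply hom_ext_single
    intro v
    simp [tupMap_single, tupBd_single, Function.comp_assoc]
  exact LinearMap.congr_fun this c

theorem tupMap_cone (f : C → D) (b : C) {k : ℕ} (c : Tup C k) :
    tupMap f (cone b c) = cone (f b) (tupMap f c) := by
  have : tupMap f ∘ₗ cone b = cone (f b) ∘ₗ tupMap f (k := k) := by
    apply hom_ext_single
    intro v
    simp [tupMap_single, cone_single, Fin.comp_cons]
  exact LinearMap.congr_fun this c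

theorem tupBd_cone_zero (b : C) (c : Tup C 0) : tupBd (cone b c) = c := by
  have : tupBd ∘ₗ cone b = LinearMap.id (R := ZMod 2) (M := Tup C 0) := by
    apply hom_ext_single
    intro v
    simp [tupBd_single, cone_single]
  exact LinearMap.congr_fun this c

/-- Deleting the apex gives back the tuple; deleting any other vertex gives a cone on a face. -/
theorem tupBd_cone (b : C) {k : ℕ} (c : Tup C (k + 1)) :
    tupBd (cone b c) = c + cone b (tupBd c) := by
  have : tupBd ∘ₗ cone b = LinearMap.id + cone b ∘ₗ tupBd (C := C) (k := k) := by
    apply hom_ext_single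
    intro v
    simp only [LinearMap.comp_apply, cone_single, tupBd_single, LinearMap.add_apply,
      LinearMap.id_apply, map_sum]
    rw [Fin.sum_univ_succ]
    refine congrArg₂ _ (congrArg (Finsupp.single · 1) (funext fun j => by simp))
      (Finset.sum_congr rfl fun i _ => congrArg (Finsupp.single · 1) (funext fun j => ?_))
    refine Fin.cases ?_ (fun j => ?_) j <;> simp
  exact LinearMap.congr_fun this c

/-- Every tuple is the cone on its tail, so the cone formula and induction replace the usual pairing
of terms in a double sum. -/
theorem tupBd_tupBd {k : ℕ} (c : Tup C (k + 2)) : tupBd (tupBd c) = 0 := by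
  have : tupBd ∘ₗ tupBd (C := C) (k := k + 1) = 0 := by
    clear c
    induction k with
    | zero =>
      apply hom_ext_single
      intro v
      rw [LinearMap.comp_apply, ← Fin.cons_self_tail v, ← cone_single, tupBd_cone, map_add,
        tupBd_cone_zero]
      exact add_self_eq_zero _
    | succ k ih =>
      apply hom_ext_single
      intro v
      rw [LinearMap.comp_apply, ← Fin.cons_self_tail v, ← cone_single, tupBd_cone, map_add,
        tupBd_cone, ← LinearMap.comp_apply tupBd tupBd, ih]
      simp [add_self_eq_zero]
  exact LinearMap.congr_fun this c

/-- The cone construction of a chain homotopy that bounds a natural family of linear maps. -/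
def coneHomotopy (b : ∀ k, (Fin (k + 1) → C) → D) (f : ∀ k, Tup C k →ₗ[ZMod 2] Tup D k) :
    ∀ k, Tup C k →ₗ[ZMod 2] Tup D (k + 1)
  | 0 => 0
  | k + 1 => Finsupp.linearCombination (ZMod 2) fun v =>
      cone (b k v) (f (k + 1) (Finsupp.single v 1) +
        coneHomotopy b f k (tupBd (Finsupp.single v 1)))

theorem coneHomotopy_single (b : ∀ k, (Fin (k + 1) → C) → D)
    (f : ∀ k, Tup C k →ₗ[ZMod 2] Tup D k) (k : ℕ) (v : Fin (k + 1) → C) :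
    coneHomotopy b f (k + 1) (Finsupp.single v 1) = cone (b k v) (f (k + 1) (Finsupp.single v 1) +
        coneHomotopy b f k (tupBd (Finsupp.single v 1))) := by
  simp [coneHomotopy]

/-- Acyclic models in cone form: by induction `f v + h (∂v)` is a cycle, so coning it off gives a
chain with that boundary. It serves both for subdivision and for prisms. -/
theorem tupBd_coneHomotopy (b : ∀ k, (Fin (k + 1) → C) → D)
    (f : ∀ k, Tup C k →ₗ[ZMod 2] Tup D k) (h0 : f 0 = 0)
    (hf : ∀ k c, tupBd (f (k + 1) c) = f k (tupBd c)) (k : ℕ) (c : Tup C (k + 1)) :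
    tupBd (coneHomotopy b f (k + 1) c) + coneHomotopy b f k (tupBd c) = f (k + 1) c := by
  have : tupBd ∘ₗ coneHomotopy b f (k + 1) + coneHomotopy b f k ∘ₗ tupBd = f (k + 1) := by
    clear c
    induction k with
    | zero =>
      apply hom_ext_single
      intro v
      simp only [LinearMap.add_apply, LinearMap.comp_apply, coneHomotopy_single, tupBd_cone,
        map_add, hf, h0]
      simp [coneHomotopy]
    | succ k ih =>
      apply hom_ext_single
      intro v
      have := LinearMap.congr_fun ih (tupBd (Finsupp.single v 1))
      simp only [LinearMap.add_apply, LinearMap.comp_apply, tupBd_tupBd, map_zero,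
        add_zero] at this
      simp only [LinearMap.add_apply, LinearMap.comp_apply, coneHomotopy_single, tupBd_cone,
        map_add, hf]
      rw [this]
      abel_nf
      simp [two_zsmul_eq_zero]
  exact LinearMap.congr_fun this c

/-- Naturality is what carries a construction on the vertices of the standard simplex over to all
singular simplices. -/
theorem coneHomotopy_tupMap {C' D' : Type*} (b : ∀ k, (Fin (k + 1) → C) → D)
    (b' : ∀ k, (Fin (k + 1) → C') → D')
    (f : ∀ k, Tup C k →ₗ[ZMod 2] Tup D k) (f' : ∀ k, Tup C' k →ₗ[ZMod 2] Tup D' k)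
    (p : C → C') (q : D → D') (hb : ∀ k v, b' k (p ∘ v) = q (b k v))
    (hf : ∀ k c, f' k (tupMap p c) = tupMap q (f k c)) (k : ℕ) (c : Tup C k) :
    coneHomotopy b' f' k (tupMap p c) = tupMap q (coneHomotopy b f k c) := by
  have : coneHomotopy b' f' k ∘ₗ tupMap p = tupMap q ∘ₗ coneHomotopy b f k := by
    clear c
    induction k with
    | zero => simp [coneHomotopy]
    | succ k ih =>
      apply hom_ext_single
      intro v
      have := LinearMap.congr_fun ih (tupBd (Finsupp.single v 1))
      simp only [LinearMap.comp_apply] at this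
      simp only [LinearMap.comp_apply, tupMap_single, coneHomotopy_single, hb, tupMap_cone,
        map_add, ← hf]
      rw [← this, ← tupBd_tupMap, tupMap_single]
  exact LinearMap.congr_fun this c

/-- Barycentric subdivision with respect to a choice `b` of barycenters. -/
def tupSd (b : ∀ k, (Fin (k + 1) → C) → C) : ∀ k, Tup C k →ₗ[ZMod 2] Tup C k
  | 0 => LinearMap.id
  | k + 1 => Finsupp.linearCombination (ZMod 2) fun v =>
      cone (b k v) (tupSd b k (tupBd (Finsupp.single v 1)))

theorem tupSd_single (b : ∀ k, (Fin (k + 1) → C) → C) (k : ℕ) (v : Fin (k + 1) → C) :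
    tupSd b (k + 1) (Finsupp.single v 1) =
      cone (b k v) (tupSd b k (tupBd (Finsupp.single v 1))) := by
  simp [tupSd]

theorem tupBd_tupSd (b : ∀ k, (Fin (k + 1) → C) → C) (k : ℕ) (c : Tup C (k + 1)) :
    tupBd (tupSd b (k + 1) c) = tupSd b k (tupBd c) := by
  have : tupBd ∘ₗ tupSd b (k + 1) = tupSd b k ∘ₗ tupBd := by
    clear c
    induction k with
    | zero =>
      apply hom_ext_single
      intro v
      simp only [LinearMap.comp_apply, tupSd_single, tupBd_cone_zero]
    | succ k ih =>
      apply hom_ext_single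
      intro v
      have := LinearMap.congr_fun ih (tupBd (Finsupp.single v 1))
      simp only [LinearMap.comp_apply] at this
      simp only [LinearMap.comp_apply, tupSd_single, tupBd_cone, this, tupBd_tupBd, map_zero,
        add_zero]
  exact LinearMap.congr_fun this c

theorem tupSd_tupMap {C' : Type*} (b : ∀ k, (Fin (k + 1) → C) → C)
    (b' : ∀ k, (Fin (k + 1) → C') → C')
    (p : C → C') (hb : ∀ k v, b' k (p ∘ v) = p (b k v)) (k : ℕ) (c : Tup C k) :
    tupSd b' k (tupMap p c) = tupMap p (tupSd b k c) := by
  have : tupSd b' k ∘ₗ tupMap p = tupMap p ∘ₗ tupSd b k := by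
    clear c
    induction k with
    | zero => rfl
    | succ k ih =>
      apply hom_ext_single
      intro v
      have := LinearMap.congr_fun ih (tupBd (Finsupp.single v 1))
      simp only [LinearMap.comp_apply] at this
      simp only [LinearMap.comp_apply, tupMap_single, tupSd_single, hb, tupMap_cone]
      rw [← this, ← tupBd_tupMap, tupMap_single]
  exact LinearMap.congr_fun this c

end Tuples

/-! ### Convex combinations -/

/-- The standard simplex with `k` vertices. -/
abbrev Simplex (k : ℕ) := stdSimplex ℝ (Fin k)

/-- Convex combinations of a tuple of points of a convex set. -/
def convexComb {V : Type*} [AddCommGroup V] [Module ℝ V] [TopologicalSpace V]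
    [ContinuousAdd V] [ContinuousSMul ℝ V] {s : Set V} (hs : Convex ℝ s) {k : ℕ}
    (w : Fin k → s) : C(Simplex k, s) where
  toFun t := ⟨∑ i, t.1 i • (w i : V),
    hs.sum_mem (fun i _ => t.2.1 i) t.2.2 (fun i _ => (w i).2)⟩
  continuous_toFun := by
    refine Continuous.subtype_mk (continuous_finsetSum _ fun i _ => ?_) _
    exact ((continuous_apply i).comp continuous_subtype_val).smul continuous_const

/-- The affine map of standard simplices with given vertices. -/
abbrev comb {j k : ℕ} (w : Fin j → Simplex k) : C(Simplex j, Simplex k) :=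
  convexComb (convex_stdSimplex ℝ (Fin k)) w

/-- A space in which finite tuples of points span affine simplices. -/
class AffineHull (D : Type*) [TopologicalSpace D] where
  hull : ∀ {k : ℕ}, (Fin k → D) → C(Simplex k, D)
  hull_vertex : ∀ {k : ℕ} (w : Fin k → D) (i : Fin k), hull w (stdSimplex.vertex i) = w i
  -- Associativity of convex combinations: affine simplices may be reparametrized affinely.
  hull_comb : ∀ {j k : ℕ} (w : Fin k → D) (v : Fin j → Simplex k) (t : Simplex j),
    hull w (comb v t) = hull (hull w ∘ v) t

open AffineHull (hull hull_vertex hull_comb)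

/-- Convex sets span affine simplices. -/
abbrev AffineHull.ofConvex {V : Type*} [AddCommGroup V] [Module ℝ V] [TopologicalSpace V]
    [ContinuousAdd V] [ContinuousSMul ℝ V] {s : Set V} (hs : Convex ℝ s) : AffineHull s where
  hull := convexComb hs
  hull_vertex w i := by
    ext
    simp [convexComb, Pi.single_apply]
  hull_comb w v t := by
    ext
    simp only [convexComb, ContinuousMap.coe_mk, Function.comp_apply, Finset.sum_apply,
      Pi.smul_apply, smul_eq_mul, Finset.sum_smul, Finset.smul_sum, mul_smul]
    exact Finset.sum_comm

instance (k : ℕ) : AffineHull (Simplex k) := AffineHull.ofConvex (convex_stdSimplex ℝ (Fin k))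

instance : AffineHull unitInterval := AffineHull.ofConvex (convex_Icc 0 1)

instance {D E : Type*} [TopologicalSpace D] [TopologicalSpace E] [AffineHull D] [AffineHull E] :
    AffineHull (D × E) where
  hull w := (hull (Prod.fst ∘ w)).prodMk (hull (Prod.snd ∘ w))
  hull_vertex w i := by simp [hull_vertex]
  hull_comb w v t := by simp [hull_comb]; constructor <;> rfl

theorem hull_simplexVertex {k : ℕ} :
    hull (fun i : Fin k => (stdSimplex.vertex i : Simplex k)) = ContinuousMap.id _ := by
  ext t i
  change (∑ j, t.1 j • (Pi.single j 1 : Fin k → ℝ)) i = t.1 i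
  simp [Pi.single_apply, Finset.sum_apply]

theorem hull_const {k : ℕ} (s : unitInterval) (t : Simplex k) :
    hull (fun _ : Fin k => s) t = s := by
  ext
  change ∑ j, t.1 j • (s : ℝ) = s
  rw [← Finset.sum_smul, t.2.2, one_smul]

/-! ### Singular chains -/

section Chains

variable {X Y Z : Type*} [TopologicalSpace X] [TopologicalSpace Y] [TopologicalSpace Z]

/-- Mod 2 singular chains on simplices with `k` vertices, augmented by the empty simplex. -/
abbrev Chain (X : Type*) [TopologicalSpace X] (k : ℕ) := C(Simplex k, X) →₀ ZMod 2

/-- The inclusion of the face opposite to the vertex `i`. -/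
def face {k : ℕ} (i : Fin (k + 1)) : C(Simplex k, Simplex (k + 1)) :=
  comb fun j => stdSimplex.vertex (i.succAbove j)

/-- The singular boundary. -/
def bd {k : ℕ} : Chain X (k + 1) →ₗ[ZMod 2] Chain X k :=
  Finsupp.linearCombination (ZMod 2) fun σ =>
    ∑ i : Fin (k + 1), Finsupp.single (σ.comp (face i)) 1

/-- The map on chains induced by a continuous map. -/
def push (g : C(X, Y)) {k : ℕ} : Chain X k →ₗ[ZMod 2] Chain Y k :=
  Finsupp.lmapDomain _ _ fun σ => g.comp σ

/-- The chains in the subset `A`. -/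
def chainsIn (A : Set X) (k : ℕ) : Submodule (ZMod 2) (Chain X k) :=
  Finsupp.supported (ZMod 2) (ZMod 2) {σ | Set.range σ ⊆ A}

theorem bd_single {k : ℕ} (σ : C(Simplex (k + 1), X)) :
    bd (Finsupp.single σ 1) = ∑ i : Fin (k + 1), Finsupp.single (σ.comp (face i)) 1 := by
  simp [bd]

theorem push_single (g : C(X, Y)) {k : ℕ} (σ : C(Simplex k, X)) :
    push g (Finsupp.single σ 1) = Finsupp.single (g.comp σ) 1 := by
  simp [push]

theorem bd_push (g : C(X, Y)) {k : ℕ} (c : Chain X (k + 1)) :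
    bd (push g c) = push g (bd c) := by
  have : bd ∘ₗ push g = push g ∘ₗ bd (k := k) := by
    apply hom_ext_single
    intro v
    simp [push_single, bd_single, ContinuousMap.comp_assoc]
  exact LinearMap.congr_fun this c

theorem push_push (h : C(Y, Z)) (g : C(X, Y)) {k : ℕ} (c : Chain X k) :
    push h (push g c) = push (h.comp g) c := by
  have : push h ∘ₗ push g = push (h.comp g) (k := k) := by
    apply hom_ext_single
    intro v
    simp [push_single, ContinuousMap.comp_assoc]
  exact LinearMap.congr_fun this c

theorem push_id {k : ℕ} (c : Chain X k) : push (ContinuousMap.id X) c = c := by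
  have : push (ContinuousMap.id X) = LinearMap.id (M := Chain X k) (R := ZMod 2) := by
    apply hom_ext_single
    intro v
    simp [push_single]
  exact LinearMap.congr_fun this c

theorem single_mem_chainsIn {A : Set X} {k : ℕ} {σ : C(Simplex k, X)} (h : Set.range σ ⊆ A) :
    Finsupp.single σ 1 ∈ chainsIn A k :=
  Finsupp.single_mem_supported _ _ h

/-- A linear map is controlled on the chains in `A` by its values on simplices. -/
theorem map_mem_of_single {α V : Type*} [AddCommGroup V] [Module (ZMod 2) V] {s : Set α}
    (f : (α →₀ ZMod 2) →ₗ[ZMod 2] V) (N : Submodule (ZMod 2) V)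
    (h : ∀ a ∈ s, f (Finsupp.single a 1) ∈ N) {c : α →₀ ZMod 2}
    (hc : c ∈ Finsupp.supported (ZMod 2) (ZMod 2) s) : f c ∈ N := by
  rw [Finsupp.supported_eq_span_single] at hc
  refine (Submodule.span_le (p := N.comap f)).2 ?_ hc
  rintro _ ⟨a, ha, rfl⟩
  exact h a ha

theorem bd_mem {A : Set X} {k : ℕ} {c : Chain X (k + 1)} (hc : c ∈ chainsIn A (k + 1)) :
    bd c ∈ chainsIn A k := by
  refine map_mem_of_single bd _ (fun σ hσ => ?_) hc
  rw [bd_single]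
  exact Submodule.sum_mem _ fun i _ => single_mem_chainsIn
    (subset_trans (Set.range_comp_subset_range (face i) σ) hσ)

theorem push_mem {A : Set X} {B : Set Y} {g : C(X, Y)} (h : Set.MapsTo g A B) {k : ℕ}
    {c : Chain X k} (hc : c ∈ chainsIn A k) : push g c ∈ chainsIn B k := by
  refine map_mem_of_single (push g) _ (fun σ hσ => ?_) hc
  rw [push_single]
  refine single_mem_chainsIn ?_
  rintro _ ⟨t, rfl⟩
  exact h (hσ ⟨t, rfl⟩)

theorem chainsIn_mono {A B : Set X} (h : A ⊆ B) (k : ℕ) : chainsIn A k ≤ chainsIn B k :=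
  Finsupp.supported_mono fun _ hσ => subset_trans hσ h

theorem mem_chainsIn_inter {A B : Set X} {k : ℕ} {c : Chain X k} (hA : c ∈ chainsIn A k)
    (hB : c ∈ chainsIn B k) : c ∈ chainsIn (A ∩ B) k := by
  rw [chainsIn, Finsupp.mem_supported] at *
  exact fun σ hσ => Set.subset_inter (hA hσ) (hB hσ)

theorem chainsIn_univ (k : ℕ) : chainsIn (Set.univ : Set X) k = ⊤ := by
  simp [chainsIn]

theorem chainsIn_empty {k : ℕ} {c : Chain X (k + 1)} (hc : c ∈ chainsIn ∅ (k + 1)) : c = 0 := by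
  have : {σ : C(Simplex (k + 1), X) | Set.range σ ⊆ ∅} = ∅ := by
    ext σ
    simp [Set.subset_empty_iff, Set.range_eq_empty_iff]
  rwa [chainsIn, this, Finsupp.supported_empty, Submodule.mem_bot] at hc

/-! ### Realization of tuples -/

variable {D D' : Type*} [TopologicalSpace D] [AffineHull D] [TopologicalSpace D'] [AffineHull D']

/-- The singular chain given by the affine simplices on the tuples of a chain. -/
def realize (g : C(D, X)) {k : ℕ} : Tup D k →ₗ[ZMod 2] Chain X k :=
  Finsupp.lmapDomain _ _ fun w => g.comp (hull w)

theorem realize_single (g : C(D, X)) {k : ℕ} (w : Fin k → D) :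
    realize g (Finsupp.single w 1) = Finsupp.single (g.comp (hull w)) 1 := by
  simp [realize]

theorem hull_comp_face {k : ℕ} (w : Fin (k + 1) → D) (i : Fin (k + 1)) :
    (hull w).comp (face i) = hull (w ∘ i.succAbove) := by
  ext t
  rw [ContinuousMap.comp_apply, face, hull_comb]
  congr 2
  funext j
  exact hull_vertex _ _

theorem bd_realize (g : C(D, X)) {k : ℕ} (c : Tup D (k + 1)) :
    bd (realize g c) = realize g (tupBd c) := by
  have : bd ∘ₗ realize g = realize g ∘ₗ tupBd (k := k) := by
    apply hom_ext_single
    intro w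
    simp [realize_single, bd_single, tupBd_single, ContinuousMap.comp_assoc, hull_comp_face]
  exact LinearMap.congr_fun this c

theorem realize_tupMap (g : C(D', X)) (p : C(D, D'))
    (hp : ∀ (j : ℕ) (w : Fin j → D), p.comp (hull w) = hull (p ∘ w)) {k : ℕ} (c : Tup D k) :
    realize g (tupMap p c) = realize (g.comp p) c := by
  have : realize g ∘ₗ tupMap p = realize (g.comp p) (k := k) := by
    apply hom_ext_single
    intro w
    simp [realize_single, tupMap_single, ContinuousMap.comp_assoc, hp]
  exact LinearMap.congr_fun this c

theorem realize_mem {A : Set X} {g : C(D, X)} (h : ∀ x, g x ∈ A) {k : ℕ} (c : Tup D k) :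
    realize g c ∈ chainsIn A k := by
  refine map_mem_of_single (s := Set.univ) (realize g) _ (fun w _ => ?_) (by simp)
  rw [realize_single]
  refine single_mem_chainsIn ?_
  rintro _ ⟨t, rfl⟩
  exact h _

/-- The tuple of vertices of the standard simplex. -/
def verts (k : ℕ) : Tup (Simplex k) k := Finsupp.single (fun i => stdSimplex.vertex i) 1

/-- Every singular simplex is the realization of one universal tuple. Read from right to left, this
reduces identities between singular chains to identities between tuples. -/
theorem realize_verts {k : ℕ} (σ : C(Simplex k, X)) : realize σ (verts k) = Finsupp.single σ 1 := by
  rw [verts, realize_single, hull_simplexVertex, ContinuousMap.comp_id]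

theorem tupMap_hull_verts {k : ℕ} (w : Fin k → D) :
    tupMap (hull w) (verts k) = Finsupp.single w 1 := by
  rw [verts, tupMap_single]
  congr 1
  funext i
  exact hull_vertex _ _

theorem comb_comp_hull {j k : ℕ} (w : Fin k → D) (v : Fin j → Simplex k) :
    (hull w).comp (hull v) = hull (hull w ∘ v) := by
  ext t
  exact hull_comb w v t

/-- The barycenter of a tuple. -/
def bary (k : ℕ) (w : Fin (k + 1) → D) : D := hull w stdSimplex.barycenter

theorem bary_comp (p : C(D, D'))
    (hp : ∀ (j : ℕ) (w : Fin j → D), p.comp (hull w) = hull (p ∘ w)) (k : ℕ)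
    (w : Fin (k + 1) → D) : bary k (p ∘ w) = p (bary k w) := by
  rw [bary, ← hp]
  rfl

/-! ### Subdivision of singular chains -/

/-- Barycentric subdivision of singular chains. -/
def subdiv {k : ℕ} : Chain X k →ₗ[ZMod 2] Chain X k :=
  Finsupp.linearCombination (ZMod 2) fun σ => realize σ (tupSd bary k (verts k))

theorem subdiv_single {k : ℕ} (σ : C(Simplex k, X)) :
    subdiv (Finsupp.single σ 1) = realize σ (tupSd bary k (verts k)) := by
  simp [subdiv]

theorem subdiv_realize {k : ℕ} (σ : C(Simplex k, X)) {j : ℕ} (c : Tup (Simplex k) j) :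
    subdiv (realize σ c) = realize σ (tupSd bary j c) := by
  have : subdiv ∘ₗ realize σ = realize σ ∘ₗ tupSd bary j := by
    apply hom_ext_single
    intro w
    have hp : ∀ (i : ℕ) (v : Fin i → Simplex j), (hull w).comp (hull v) = hull (hull w ∘ v) :=
      fun _ v => comb_comp_hull w v
    rw [LinearMap.comp_apply, LinearMap.comp_apply, realize_single, subdiv_single,
      ← realize_tupMap _ _ hp, ← tupSd_tupMap bary bary _ (bary_comp _ hp), tupMap_hull_verts]
  exact LinearMap.congr_fun this c

theorem bd_subdiv {k : ℕ} (c : Chain X (k + 1)) : bd (subdiv c) = subdiv (bd c) := by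
  have : bd ∘ₗ subdiv = subdiv ∘ₗ bd (X := X) (k := k) := by
    apply hom_ext_single
    intro σ
    simp only [LinearMap.comp_apply]
    rw [← realize_verts σ, subdiv_realize, bd_realize, bd_realize, tupBd_tupSd, subdiv_realize]
  exact LinearMap.congr_fun this c

theorem subdiv_mem {A : Set X} {k : ℕ} {c : Chain X k} (hc : c ∈ chainsIn A k) :
    subdiv c ∈ chainsIn A k := by
  refine map_mem_of_single subdiv _ (fun σ hσ => ?_) hc
  rw [subdiv_single]
  exact realize_mem (fun x => hσ ⟨x, rfl⟩) _

/-- The chain homotopy of tuples between the identity and the subdivision. -/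
abbrev tupSdHomotopy (D : Type*) [TopologicalSpace D] [AffineHull D] (k : ℕ) :
    Tup D k →ₗ[ZMod 2] Tup D (k + 1) :=
  coneHomotopy bary (fun k => LinearMap.id + tupSd bary k) k

theorem tupBd_tupSdHomotopy {k : ℕ} (c : Tup D (k + 1)) :
    tupBd (tupSdHomotopy D (k + 1) c) + tupSdHomotopy D k (tupBd c) = c + tupSd bary (k + 1) c := by
  refine tupBd_coneHomotopy _ _ ?_ (fun k c => ?_) _ _
  · ext1 c
    exact LinearMap.ext_ring (add_self_eq_zero _)
  · simp [tupBd_tupSd]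

/-- The chain homotopy between the identity and the barycentric subdivision. -/
def subdivHomotopy {k : ℕ} : Chain X k →ₗ[ZMod 2] Chain X (k + 1) :=
  Finsupp.linearCombination (ZMod 2) fun σ => realize σ (tupSdHomotopy _ k (verts k))

theorem subdivHomotopy_single {k : ℕ} (σ : C(Simplex k, X)) :
    subdivHomotopy (Finsupp.single σ 1) = realize σ (tupSdHomotopy _ k (verts k)) := by
  simp [subdivHomotopy]

theorem subdivHomotopy_realize {k : ℕ} (σ : C(Simplex k, X)) {j : ℕ} (c : Tup (Simplex k) j) :
    subdivHomotopy (realize σ c) = realize σ (tupSdHomotopy _ j c) := by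
  have : subdivHomotopy ∘ₗ realize σ = realize σ ∘ₗ tupSdHomotopy _ j := by
    apply hom_ext_single
    intro w
    have hp : ∀ (i : ℕ) (v : Fin i → Simplex j), (hull w).comp (hull v) = hull (hull w ∘ v) :=
      fun _ v => comb_comp_hull w v
    rw [LinearMap.comp_apply, LinearMap.comp_apply, realize_single, subdivHomotopy_single,
      ← realize_tupMap _ _ hp, ← coneHomotopy_tupMap bary bary _ _ _ _ (bary_comp _ hp),
      tupMap_hull_verts]
    intro k c
    simp [tupSd_tupMap bary bary _ (bary_comp _ hp)]
  exact LinearMap.congr_fun this c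

theorem bd_subdivHomotopy {k : ℕ} (c : Chain X (k + 1)) :
    bd (subdivHomotopy c) + subdivHomotopy (bd c) = c + subdiv c := by
  have : bd ∘ₗ subdivHomotopy + subdivHomotopy ∘ₗ bd =
      LinearMap.id + subdiv (X := X) (k := k + 1) := by
    apply hom_ext_single
    intro σ
    simp only [LinearMap.comp_apply, LinearMap.add_apply, LinearMap.id_apply]
    rw [← realize_verts σ, subdivHomotopy_realize, bd_realize, bd_realize, subdivHomotopy_realize,
      subdiv_realize, ← map_add, tupBd_tupSdHomotopy, map_add]
  exact LinearMap.congr_fun this c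

theorem subdivHomotopy_mem {A : Set X} {k : ℕ} {c : Chain X k} (hc : c ∈ chainsIn A k) :
    subdivHomotopy c ∈ chainsIn A (k + 1) := by
  refine map_mem_of_single subdivHomotopy _ (fun σ hσ => ?_) hc
  rw [subdivHomotopy_single]
  exact realize_mem (fun x => hσ ⟨x, rfl⟩) _

/-! ### The prism operator -/

/-- The chain homotopy of tuples between the two ends of a prism. -/
abbrev tupPrism (D : Type*) (k : ℕ) : Tup D k →ₗ[ZMod 2] Tup (D × unitInterval) (k + 1) :=
  coneHomotopy (fun _ v => (v 0, 0))
    (fun _ => tupMap (fun x => (x, (0 : unitInterval))) + tupMap (fun x => (x, 1))) k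

theorem tupBd_tupPrism {D : Type*} {k : ℕ} (c : Tup D (k + 1)) :
    tupBd (tupPrism D (k + 1) c) + tupPrism D k (tupBd c) =
      tupMap (fun x => (x, (0 : unitInterval))) c + tupMap (fun x => (x, 1)) c := by
  refine tupBd_coneHomotopy _ _ ?_ (fun k c => ?_) _ _
  · apply hom_ext_single
    intro v
    rw [LinearMap.add_apply, tupMap_single, tupMap_single]
    -- On the empty tuple the two ends coincide, so they cancel mod 2.
    rw [Subsingleton.elim ((fun x => (x, (0 : unitInterval))) ∘ v) ((fun x => (x, 1)) ∘ v)]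
    exact add_self_eq_zero _
  · simp [tupBd_tupMap]

/-- The map from the prism over a simplex given by a homotopy. -/
abbrev prismMap (H : C(unitInterval × X, Y)) {k : ℕ} (σ : C(Simplex k, X)) :
    C(Simplex k × unitInterval, Y) :=
  H.comp (ContinuousMap.snd.prodMk (σ.comp ContinuousMap.fst))

/-- The prism operator of a homotopy. -/
def prism (H : C(unitInterval × X, Y)) {k : ℕ} : Chain X k →ₗ[ZMod 2] Chain Y (k + 1) :=
  Finsupp.linearCombination (ZMod 2) fun σ => realize (prismMap H σ) (tupPrism _ k (verts k))

theorem prism_single (H : C(unitInterval × X, Y)) {k : ℕ} (σ : C(Simplex k, X)) :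
    prism H (Finsupp.single σ 1) = realize (prismMap H σ) (tupPrism _ k (verts k)) := by
  simp [prism]

theorem prism_realize (H : C(unitInterval × X, Y)) {k : ℕ} (σ : C(Simplex k, X)) {j : ℕ}
    (c : Tup (Simplex k) j) :
    prism H (realize σ c) = realize (prismMap H σ) (tupPrism _ j c) := by
  have : prism H ∘ₗ realize σ = realize (prismMap H σ) ∘ₗ tupPrism _ j := by
    apply hom_ext_single
    intro w
    have hp : ∀ (i : ℕ) (v : Fin i → Simplex j × unitInterval),
        ((hull w).prodMap (ContinuousMap.id unitInterval)).comp (hull v) =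
          hull ((hull w).prodMap (ContinuousMap.id unitInterval) ∘ v) := by
      intro i v
      ext1 t
      exact Prod.ext (hull_comb w (Prod.fst ∘ v) t) rfl
    rw [LinearMap.comp_apply, LinearMap.comp_apply, realize_single, prism_single,
      show prismMap H (σ.comp (hull w)) =
        (prismMap H σ).comp ((hull w).prodMap (ContinuousMap.id unitInterval)) from rfl,
      ← realize_tupMap _ _ hp, ← tupMap_hull_verts w]
    congr 1
    refine (coneHomotopy_tupMap _ _ _ _ _ _ (fun _ _ => rfl) (fun i c => ?_) _ _).symm
    have (s : unitInterval) : tupMap (fun x => (x, s)) ∘ₗ tupMap (hull w) =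
        tupMap ((hull w).prodMap (ContinuousMap.id unitInterval)) ∘ₗ
          tupMap (fun x => (x, s)) (k := i) := by
      apply hom_ext_single
      intro v
      simp only [LinearMap.comp_apply, tupMap_single]
      rfl
    have h0 := LinearMap.congr_fun (this 0) c
    have h1 := LinearMap.congr_fun (this 1) c
    simp only [LinearMap.comp_apply] at h0 h1
    simp [h0, h1]
  exact LinearMap.congr_fun this c

theorem realize_prismMap_end (H : C(unitInterval × X, Y)) (s : unitInterval) (g : C(X, Y))
    (hg : ∀ x, H (s, x) = g x) {k : ℕ} (σ : C(Simplex k, X)) :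
    realize (prismMap H σ) (tupMap (fun x => (x, s)) (verts k)) =
      Finsupp.single (g.comp σ) 1 := by
  rw [verts, tupMap_single, realize_single]
  congr 1
  ext t
  refine Eq.trans ?_ (hg (σ t))
  change H (hull (fun _ => s) t, σ (hull (fun i => stdSimplex.vertex i) t)) = _
  rw [hull_const, hull_simplexVertex]
  rfl

theorem bd_prism {f g : C(X, Y)} (H : f.Homotopy g) {k : ℕ} (c : Chain X (k + 1)) :
    bd (prism H.toContinuousMap c) + prism H.toContinuousMap (bd c) = push f c + push g c := by
  have : bd ∘ₗ prism H.toContinuousMap + prism H.toContinuousMap ∘ₗ bd (k := k) =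
      push f + push g := by
    apply hom_ext_single
    intro σ
    simp only [LinearMap.comp_apply, LinearMap.add_apply]
    rw [push_single, push_single, ← realize_prismMap_end H.toContinuousMap 0 f (by simp),
      ← realize_prismMap_end H.toContinuousMap 1 g (by simp), ← map_add, ← tupBd_tupPrism, map_add,
      ← realize_verts σ, prism_realize, bd_realize, bd_realize, prism_realize]
  exact LinearMap.congr_fun this c

theorem prism_mem {A : Set X} {B : Set Y} {H : C(unitInterval × X, Y)}
    (h : ∀ s, ∀ x ∈ A, H (s, x) ∈ B) {k : ℕ} {c : Chain X k} (hc : c ∈ chainsIn A k) :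
    prism H c ∈ chainsIn B (k + 1) := by
  refine map_mem_of_single (prism H) _ (fun σ hσ => ?_) hc
  rw [prism_single]
  exact realize_mem (g := prismMap H σ) (fun x => h _ _ (hσ ⟨x.1, rfl⟩)) _

end Chains

/-! ### Small simplices -/

theorem dist_hull_le {n k : ℕ} (v : Fin k → Simplex n) (p : Simplex n) {R : ℝ}
    (h : ∀ a, dist p (v a) ≤ R) (t : Simplex k) : dist p (hull v t) ≤ R := by
  rw [dist_comm]
  refine (convex_closedBall (p : Fin n → ℝ) R).sum_mem (fun i _ => t.2.1 i) t.2.2 fun i _ => ?_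
  rw [Metric.mem_closedBall, dist_comm]
  exact h i

/-- The vector from `v a` to the barycenter is the average of the `v i - v a`. One of these `k + 1`
terms is zero, whence the factor `k / (k + 1)`. -/
theorem dist_bary_le {n k : ℕ} (v : Fin (k + 1) → Simplex n) {R : ℝ}
    (h : ∀ a b, dist (v a) (v b) ≤ R) (a : Fin (k + 1)) :
    dist (bary k v) (v a) ≤ (1 - 1 / (k + 1 : ℕ)) * R := by
  have hk : ((k + 1 : ℕ) : ℝ) ≠ 0 := by positivity
  have e : (bary k v).1 - (v a).1 =
      ∑ i, ((k + 1 : ℕ) : ℝ)⁻¹ • ((v i).1 - (v a).1) := by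
    rw [← Finset.smul_sum, Finset.sum_sub_distrib, smul_sub, Finset.smul_sum]
    congr 1
    · change ∑ i, ((Fintype.card (Fin (k + 1)) : ℕ) : ℝ)⁻¹ • (v i).1 = _
      simp only [Fintype.card_fin]
    · rw [Finset.sum_const, Finset.card_univ, Fintype.card_fin, ← Nat.cast_smul_eq_nsmul ℝ,
        smul_smul, inv_mul_cancel₀ hk, one_smul]
  have hb : ∀ i, ‖((k + 1 : ℕ) : ℝ)⁻¹ • ((v i).1 - (v a).1)‖ ≤
      if i = a then 0 else ((k + 1 : ℕ) : ℝ)⁻¹ * R := by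
    intro i
    split_ifs with hi
    · simp [hi]
    · rw [norm_smul, norm_inv, RCLike.norm_natCast, ← dist_eq_norm]
      exact mul_le_mul_of_nonneg_left (h i a) (by positivity)
  rw [Subtype.dist_eq, dist_eq_norm, e]
  refine (norm_sum_le_of_le _ fun i _ => hb i).trans_eq ?_
  rw [Finset.sum_ite, Finset.sum_const_zero, zero_add, Finset.sum_const, Finset.filter_ne',
    Finset.card_erase_of_mem (Finset.mem_univ _), Finset.card_univ, Fintype.card_fin,
    nsmul_eq_mul]
  push_cast
  field_simp
  simp [mul_comm]

/-- Subdivision shrinks the edges of affine simplices. -/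
theorem tupSd_mem_of_dist_le {n k : ℕ} (v : Fin k → Simplex n) {R : ℝ}
    (h : ∀ a b, dist (v a) (v b) ≤ R) :
    tupSd bary k (Finsupp.single v 1) ∈ Finsupp.supported (ZMod 2) (ZMod 2)
      {w : Fin k → Simplex n | (∀ i, w i ∈ Set.range (hull v)) ∧
        ∀ a b, dist (w a) (w b) ≤ (1 - 1 / (k : ℕ)) * R} := by
  induction k with
  | zero => exact Finsupp.single_mem_supported _ _ ⟨fun i => i.elim0, fun i => i.elim0⟩
  | succ k ih =>
    rw [tupSd_single, tupBd_single, map_sum, map_sum]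
    refine Submodule.sum_mem _ fun i _ => ?_
    refine map_mem_of_single _ _ (fun w hw => ?_) (ih (v ∘ i.succAbove) fun a b => h _ _)
    rw [cone_single]
    -- The range condition is carried through the induction for this: it bounds the distance from
    -- the new barycenter to the vertices that subdivide a face.
    have hsub : ∀ l, w l ∈ Set.range (hull v) := fun l => by
      obtain ⟨t, ht⟩ := hw.1 l
      exact ⟨face i t, by rw [← ht, ← hull_comp_face]; rfl⟩
    have hR : 0 ≤ R := dist_nonneg.trans (h 0 0)
    have hk : (0 : ℝ) ≤ 1 - 1 / (k + 1 : ℕ) := by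
      rw [sub_nonneg, div_le_one (by positivity)]
      exact_mod_cast Nat.le_add_left 1 k
    have hb : ∀ l, dist (bary k v) (w l) ≤ (1 - 1 / (k + 1 : ℕ)) * R := fun l => by
      obtain ⟨t, ht⟩ := hsub l
      rw [← ht]
      exact dist_hull_le v _ (dist_bary_le v h) t
    refine Finsupp.single_mem_supported _ _ ⟨Fin.cases ⟨_, rfl⟩ hsub,
      Fin.cases (Fin.cases ?_ fun l => ?_) fun l => Fin.cases ?_ fun l' => ?_⟩
    · simpa using mul_nonneg hk hR
    · simpa using hb l
    · simpa [dist_comm] using hb l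
    · simp only [Fin.cons_succ]
      refine (hw.2 l l').trans (mul_le_mul_of_nonneg_right ?_ hR)
      -- A face has one vertex fewer, so its factor `1 - 1 / k` is at most `1 - 1 / (k + 1)`; `l :
      -- Fin k` excludes `k = 0`.
      have : 0 < (k : ℝ) := by exact_mod_cast l.pos
      have := one_div_le_one_div_of_le this (show (k : ℝ) ≤ (k + 1 : ℕ) by push_cast; linarith)
      linarith

theorem tupSd_pow_verts (k r : ℕ) :
    (tupSd bary k ^ r) (verts k) ∈ Finsupp.supported (ZMod 2) (ZMod 2)
      {w : Fin k → Simplex k | ∀ a b, dist (w a) (w b) ≤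
        (1 - 1 / (k : ℕ)) ^ r * Metric.diam (Set.univ : Set (Simplex k))} := by
  induction r with
  | zero =>
    refine Finsupp.single_mem_supported _ _ fun a b => ?_
    rw [pow_zero, one_mul]
    exact Metric.dist_le_diam_of_mem isCompact_univ.isBounded trivial trivial
  | succ r ih =>
    rw [pow_succ' (tupSd bary k), Module.End.mul_apply]
    refine map_mem_of_single _ _ (fun w hw => ?_) ih
    refine Finsupp.supported_mono ?_ (tupSd_mem_of_dist_le w hw)
    rintro w' ⟨-, hw'⟩ a b
    rw [pow_succ', mul_assoc]
    exact hw' a b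

/-! ### Splitting chains along open covers -/

section Chains

variable {X : Type*} [TopologicalSpace X]

/-- The chains of simplices each of which lies in a member of the family `𝒰`. -/
def smallChains (𝒰 : Set (Set X)) (k : ℕ) : Submodule (ZMod 2) (Chain X k) :=
  Finsupp.supported (ZMod 2) (ZMod 2) {σ | ∃ u ∈ 𝒰, Set.range σ ⊆ u}

theorem subdiv_mem_smallChains {𝒰 : Set (Set X)} {k : ℕ} {c : Chain X k}
    (hc : c ∈ smallChains 𝒰 k) : subdiv c ∈ smallChains 𝒰 k := by
  refine map_mem_of_single subdiv _ (fun σ hσ => ?_) hc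
  obtain ⟨u, hu, hσ⟩ := hσ
  refine Finsupp.supported_mono ?_ (subdiv_mem (single_mem_chainsIn hσ))
  exact fun τ hτ => ⟨u, hu, hτ⟩

theorem subdiv_pow_mem_smallChains {𝒰 : Set (Set X)} {k r s : ℕ} (hrs : r ≤ s) {c : Chain X k}
    (hc : (subdiv ^ r) c ∈ smallChains 𝒰 k) : (subdiv ^ s) c ∈ smallChains 𝒰 k := by
  induction s, hrs using Nat.le_induction with
  | base => exact hc
  | succ s _ ih =>
    rw [pow_succ', Module.End.mul_apply]
    exact subdiv_mem_smallChains ih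

theorem subdiv_pow_realize {k : ℕ} (σ : C(Simplex k, X)) (r : ℕ) (c : Tup (Simplex k) k) :
    (subdiv ^ r) (realize σ c) = realize σ ((tupSd bary k ^ r) c) := by
  induction r with
  | zero => rfl
  | succ r ih =>
    rw [pow_succ', pow_succ', Module.End.mul_apply, Module.End.mul_apply, ih, subdiv_realize]

/-- Take a Lebesgue number `δ` of the cover pulled back to the simplex, and subdivide until the
edges are shorter than `δ`. -/
theorem exists_subdiv_single_mem {𝒰 : Set (Set X)} (h𝒰 : ∀ u ∈ 𝒰, IsOpen u) {k : ℕ}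
    (σ : C(Simplex (k + 1), X)) (hσ : Set.range σ ⊆ ⋃₀ 𝒰) :
    ∃ r, (subdiv ^ r) (Finsupp.single σ 1) ∈ smallChains 𝒰 (k + 1) := by
  obtain ⟨δ, hδ, hball⟩ := lebesgue_number_lemma_of_metric (s := Set.univ)
    (c := fun u : 𝒰 => σ ⁻¹' u) isCompact_univ (fun u => (h𝒰 u u.2).preimage σ.continuous)
    (fun t _ => by
      obtain ⟨u, hu, ht⟩ := hσ ⟨t, rfl⟩
      exact Set.mem_iUnion.2 ⟨⟨u, hu⟩, ht⟩)
  have hk0 : (0 : ℝ) ≤ 1 - 1 / (k + 1 : ℕ) := by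
    rw [sub_nonneg, div_le_one (by positivity)]
    exact_mod_cast Nat.le_add_left 1 k
  have hk1 : (1 : ℝ) - 1 / (k + 1 : ℕ) < 1 := by
    rw [sub_lt_self_iff]
    positivity
  have hlim := (tendsto_pow_atTop_nhds_zero_of_lt_one hk0 hk1).mul_const
    (Metric.diam (Set.univ : Set (Simplex (k + 1))))
  rw [zero_mul] at hlim
  obtain ⟨r, hr⟩ := (hlim.eventually_lt_const hδ).exists
  refine ⟨r, ?_⟩
  rw [← realize_verts, subdiv_pow_realize]
  refine map_mem_of_single _ _ (fun w hw => ?_) (tupSd_pow_verts (k + 1) r)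
  rw [realize_single]
  obtain ⟨u, hu⟩ := hball (w 0) trivial
  refine Finsupp.single_mem_supported _ _ ⟨u, u.2, ?_⟩
  rintro _ ⟨t, rfl⟩
  refine hu ?_
  rw [Metric.mem_ball, dist_comm]
  exact (dist_hull_le w _ (hw 0) t).trans_lt hr

theorem exists_subdiv_mem {𝒰 : Set (Set X)} (h𝒰 : ∀ u ∈ 𝒰, IsOpen u) {k : ℕ}
    {c : Chain X (k + 1)} (hc : c ∈ chainsIn (⋃₀ 𝒰) (k + 1)) :
    ∃ r, (subdiv ^ r) c ∈ smallChains 𝒰 (k + 1) := by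
  rw [chainsIn, Finsupp.supported_eq_span_single] at hc
  induction hc using Submodule.span_induction with
  | mem x hx =>
    obtain ⟨σ, hσ, rfl⟩ := hx
    exact exists_subdiv_single_mem h𝒰 σ hσ
  | zero => exact ⟨0, by simp⟩
  | add x y _ _ hx hy =>
    obtain ⟨r, hr⟩ := hx
    obtain ⟨s, hs⟩ := hy
    refine ⟨max r s, ?_⟩
    rw [map_add]
    exact Submodule.add_mem _ (subdiv_pow_mem_smallChains (le_max_left _ _) hr)
      (subdiv_pow_mem_smallChains (le_max_right _ _) hs)
  | smul a x _ hx =>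
    obtain ⟨r, hr⟩ := hx
    refine ⟨r, ?_⟩
    rw [map_smul]
    exact Submodule.smul_mem _ _ hr

/-- A linear operator on chains that preserves supports. -/
def Local {j k : ℕ} (T : Chain X j →ₗ[ZMod 2] Chain X k) : Prop :=
  ∀ (A : Set X) (c : Chain X j), c ∈ chainsIn A j → T c ∈ chainsIn A k

/-- The homotopies from `subdiv ^ i` to `subdiv ^ (i + 1)` telescope. `T` and `T'` are the same
operator in two adjacent degrees. -/
theorem exists_homotopy_subdiv_pow (X : Type*) [TopologicalSpace X] (k r : ℕ) :
    ∃ (T : Chain X (k + 1) →ₗ[ZMod 2] Chain X (k + 2)) (T' : Chain X k →ₗ[ZMod 2] Chain X (k + 1)),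
      Local T ∧ Local T' ∧ ∀ c, bd (T c) + T' (bd c) = c + (subdiv ^ r) c := by
  have hpow : ∀ r : ℕ, (∀ j, Local (subdiv ^ r : Module.End (ZMod 2) (Chain X j))) ∧
      ∀ c : Chain X (k + 1), bd ((subdiv ^ r) c) = (subdiv ^ r) (bd c) := by
    intro r
    induction r with
    | zero => exact ⟨fun _ _ _ hc => hc, fun _ => rfl⟩
    | succ r ih =>
      refine ⟨fun j A c hc => ?_, fun c => ?_⟩
      · rw [pow_succ', Module.End.mul_apply]
        exact subdiv_mem (ih.1 _ _ _ hc)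
      · simp only [pow_succ', Module.End.mul_apply]
        rw [bd_subdiv, ih.2]
  induction r with
  | zero =>
    refine ⟨0, 0, fun A c _ => by simp, fun A c _ => by simp, fun c => ?_⟩
    simp [add_self_eq_zero]
  | succ r ih =>
    obtain ⟨T, T', hT, hT', h⟩ := ih
    refine ⟨T + subdivHomotopy ∘ₗ subdiv ^ r, T' + subdivHomotopy ∘ₗ subdiv ^ r,
      fun A c hc => Submodule.add_mem _ (hT A c hc) (subdivHomotopy_mem ((hpow r).1 _ A c hc)),
      fun A c hc => Submodule.add_mem _ (hT' A c hc) (subdivHomotopy_mem ((hpow r).1 _ A c hc)),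
      fun c => ?_⟩
    have h1 := bd_subdivHomotopy ((subdiv ^ r) c)
    rw [(hpow r).2] at h1
    rw [pow_succ', Module.End.mul_apply]
    simp only [LinearMap.add_apply, LinearMap.comp_apply, map_add]
    rw [add_add_add_comm, h, h1]
    abel_nf
    simp [two_zsmul_eq_zero]

/-- Local operators are returned rather than mere correction chains, so that `T'` can be applied
separately to the summands of `bd c` and each result stays in the support of its summand. -/
theorem exists_small {𝒰 : Set (Set X)} (h𝒰 : ∀ u ∈ 𝒰, IsOpen u) {k : ℕ}
    {c : Chain X (k + 1)} (hc : c ∈ chainsIn (⋃₀ 𝒰) (k + 1)) :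
    ∃ (T : Chain X (k + 1) →ₗ[ZMod 2] Chain X (k + 2)) (T' : Chain X k →ₗ[ZMod 2] Chain X (k + 1)),
      Local T ∧ Local T' ∧ c + bd (T c) + T' (bd c) ∈ smallChains 𝒰 (k + 1) := by
  obtain ⟨r, hr⟩ := exists_subdiv_mem h𝒰 hc
  obtain ⟨T, T', hT, hT', h⟩ := exists_homotopy_subdiv_pow X k r
  refine ⟨T, T', hT, hT', ?_⟩
  rwa [add_assoc, h, ← add_assoc, add_self_eq_zero, zero_add]

theorem exists_split {A B : Set X} (hA : IsOpen A) (hB : IsOpen B) {k : ℕ}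
    {c : Chain X (k + 1)} (hc : c ∈ chainsIn (A ∪ B) (k + 1)) :
    ∃ (T : Chain X (k + 1) →ₗ[ZMod 2] Chain X (k + 2)) (T' : Chain X k →ₗ[ZMod 2] Chain X (k + 1)),
      Local T ∧ Local T' ∧ ∃ a ∈ chainsIn A (k + 1), ∃ b ∈ chainsIn B (k + 1),
        c + bd (T c) + T' (bd c) = a + b := by
  obtain ⟨T, T', hT, hT', h⟩ := exists_small (𝒰 := {A, B}) (by simp [hA, hB])
    (by rwa [Set.sUnion_pair])
  refine ⟨T, T', hT, hT', ?_⟩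
  have e : smallChains {A, B} (k + 1) = chainsIn A (k + 1) ⊔ chainsIn B (k + 1) := by
    rw [chainsIn, chainsIn, ← Finsupp.supported_union, smallChains]
    congr 1
    ext σ
    simp
  rw [e, Submodule.mem_sup] at h
  obtain ⟨a, ha, b, hb, hab⟩ := h
  exact ⟨a, ha, b, hb, hab.symm⟩

theorem exists_split₃ {A B C : Set X} (hA : IsOpen A) (hB : IsOpen B) (hC : IsOpen C) {k : ℕ}
    {c : Chain X (k + 1)} (hc : c ∈ chainsIn (A ∪ (B ∪ C)) (k + 1)) :
    ∃ (T : Chain X (k + 1) →ₗ[ZMod 2] Chain X (k + 2)) (T' : Chain X k →ₗ[ZMod 2] Chain X (k + 1)),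
      Local T ∧ Local T' ∧ ∃ a ∈ chainsIn A (k + 1), ∃ b ∈ chainsIn B (k + 1),
        ∃ d ∈ chainsIn C (k + 1), c + bd (T c) + T' (bd c) = a + (b + d) := by
  obtain ⟨T, T', hT, hT', h⟩ := exists_small (𝒰 := {A, B, C}) (by simp [hA, hB, hC])
    (by rwa [Set.sUnion_insert, Set.sUnion_pair])
  refine ⟨T, T', hT, hT', ?_⟩
  have e : smallChains {A, B, C} (k + 1) =
      chainsIn A (k + 1) ⊔ (chainsIn B (k + 1) ⊔ chainsIn C (k + 1)) := by
    rw [chainsIn, chainsIn, chainsIn, ← Finsupp.supported_union, ← Finsupp.supported_union,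
      smallChains]
    congr 1
    ext σ
    simp
  rw [e, Submodule.mem_sup] at h
  obtain ⟨a, ha, x, hx, hab⟩ := h
  obtain ⟨b, hb, d, hd, rfl⟩ := Submodule.mem_sup.1 hx
  exact ⟨a, ha, b, hb, d, hd, hab.symm⟩

end Chains

section Relative

variable {X Y : Type*} [TopologicalSpace X] [TopologicalSpace Y]

theorem bd_bd {k : ℕ} (c : Chain X (k + 2)) : bd (bd c) = 0 := by
  have : bd ∘ₗ bd (X := X) (k := k + 1) = 0 := by
    apply hom_ext_single
    intro σ
    rw [LinearMap.comp_apply, ← realize_verts, bd_realize, bd_realize, tupBd_tupBd, map_zero,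
      LinearMap.zero_apply]
  exact LinearMap.congr_fun this c

/-! ### Relative cycles and boundaries -/

/-- `c` is a cycle modulo the subspace `A`. -/
def RelCycle (A : Set X) {k : ℕ} (c : Chain X (k + 1)) : Prop := bd c ∈ chainsIn A k

/-- `c` is a boundary modulo the subspace `A`. -/
def Null (A : Set X) {k : ℕ} (c : Chain X (k + 1)) : Prop :=
  ∃ d : Chain X (k + 2), c + bd d ∈ chainsIn A (k + 1)

/-- The homology of `X` modulo `A` vanishes in degree `k`. -/
def Vanishes (A : Set X) (k : ℕ) : Prop :=
  ∀ c : Chain X (k + 1), RelCycle A c → Null A c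

/-- The homology of `X` modulo `A` has at most one nonzero class in degree `k`. -/
def AtMostOneClass (A : Set X) (k : ℕ) : Prop :=
  ∀ c c' : Chain X (k + 1), RelCycle A c → RelCycle A c' → ¬ Null A c → ¬ Null A c' →
    Null A (c + c')

theorem Null.mono {A B : Set X} (h : A ⊆ B) {k : ℕ} {c : Chain X (k + 1)} (hc : Null A c) :
    Null B c :=
  hc.imp fun _ hd => chainsIn_mono h _ hd

theorem RelCycle.mono {A B : Set X} (h : A ⊆ B) {k : ℕ} {c : Chain X (k + 1)}
    (hc : RelCycle A c) : RelCycle B c :=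
  chainsIn_mono h _ hc

theorem Null.add {A : Set X} {k : ℕ} {c c' : Chain X (k + 1)} (hc : Null A c) (hc' : Null A c') :
    Null A (c + c') := by
  obtain ⟨d, hd⟩ := hc
  obtain ⟨d', hd'⟩ := hc'
  refine ⟨d + d', ?_⟩
  rw [map_add, add_add_add_comm]
  exact Submodule.add_mem _ hd hd'

theorem null_of_mem {A : Set X} {k : ℕ} {c : Chain X (k + 1)} (hc : c ∈ chainsIn A (k + 1)) :
    Null A c :=
  ⟨0, by simpa using hc⟩

theorem null_bd {A : Set X} {k : ℕ} (d : Chain X (k + 2)) : Null A (bd d) :=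
  ⟨d, by simp [add_self_eq_zero]⟩

theorem Null.of_add {A : Set X} {k : ℕ} {c c' : Chain X (k + 1)} (h : Null A (c + c'))
    (hc' : Null A c') : Null A c := by
  have := h.add hc'
  rwa [add_assoc, add_self_eq_zero, add_zero] at this

theorem RelCycle.add {A : Set X} {k : ℕ} {c c' : Chain X (k + 1)} (hc : RelCycle A c)
    (hc' : RelCycle A c') : RelCycle A (c + c') := by
  rw [RelCycle, map_add]
  exact Submodule.add_mem _ hc hc'

theorem Null.map {A : Set X} {B : Set Y} {g : C(X, Y)} (h : Set.MapsTo g A B) {k : ℕ}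
    {c : Chain X (k + 1)} (hc : Null A c) : Null B (push g c) := by
  obtain ⟨d, hd⟩ := hc
  refine ⟨push g d, ?_⟩
  rw [bd_push, ← map_add]
  exact push_mem h hd

theorem null_push_add_push {f g : C(X, Y)} (H : f.Homotopy g) {A : Set X} {B : Set Y}
    (h : ∀ s, ∀ x ∈ A, H (s, x) ∈ B) {k : ℕ} {c : Chain X (k + 1)} (hc : RelCycle A c) :
    Null B (push f c + push g c) := by
  rw [← bd_prism H]
  exact (null_bd _).add (null_of_mem (prism_mem h hc))

/-- The contraction pushes every chain to a point of `A`, and it keeps `A` inside `A`. -/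
theorem vanishes_of_homotopy {A : Set X} {p : X} (hp : p ∈ A)
    (H : (ContinuousMap.id X).Homotopy (ContinuousMap.const X p))
    (h : ∀ s, ∀ x ∈ A, H (s, x) ∈ A) (k : ℕ) : Vanishes A k := fun c hc => by
  have := null_push_add_push H h hc
  rw [push_id] at this
  refine this.of_add (null_of_mem (push_mem (A := Set.univ) (fun _ _ => hp) ?_))
  rw [chainsIn_univ]
  trivial

/-! ### Mayer-Vietoris arguments -/

/-- The chains `c` and `a` represent classes related by the connecting homomorphism of the
Mayer-Vietoris sequence of `A` and `B`. -/
def Connects (A B : Set X) {k : ℕ} (c : Chain X (k + 2)) (a : Chain X (k + 1)) : Prop :=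
  a ∈ chainsIn A (k + 1) ∧ ∃ e ∈ chainsIn (A ∪ B) (k + 2), bd (c + e) + a ∈ chainsIn B (k + 1)

theorem Connects.add {A B : Set X} {k : ℕ} {c c' : Chain X (k + 2)} {a a' : Chain X (k + 1)}
    (h : Connects A B c a) (h' : Connects A B c' a') : Connects A B (c + c') (a + a') := by
  obtain ⟨ha, e, he, h⟩ := h
  obtain ⟨ha', e', he', h'⟩ := h'
  refine ⟨Submodule.add_mem _ ha ha', e + e', Submodule.add_mem _ he he', ?_⟩
  rw [add_add_add_comm, map_add, add_add_add_comm]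
  exact Submodule.add_mem _ h h'

/-- Split `bd c` after subdivision as `a + b`. This sum is a boundary, so `bd a = bd b` lies in both
`A` and `B`. -/
theorem exists_connects {A B : Set X} (hA : IsOpen A) (hB : IsOpen B) {k : ℕ}
    {c : Chain X (k + 2)} (hc : RelCycle (A ∪ B) c) :
    ∃ a, Connects A B c a ∧ RelCycle (A ∩ B) a := by
  obtain ⟨T, T', hT, -, a, ha, b, hb, hab⟩ := exists_split hA hB hc
  rw [bd_bd, map_zero, add_zero, ← map_add] at hab
  refine ⟨a, ⟨ha, T (bd c), hT _ _ hc, ?_⟩, mem_chainsIn_inter (bd_mem ha) ?_⟩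
  · rw [hab, add_comm a, add_assoc, add_self_eq_zero, add_zero]
    exact hb
  · have := congrArg bd hab
    rw [bd_bd, map_add] at this
    rw [eq_of_add_eq_zero this.symm]
    exact bd_mem hb

/-- Injectivity of the connecting homomorphism. If `d` kills `a` modulo `A ∩ B`, then `d` is a cycle
modulo `A` and `c + e + d` is one modulo `B`; both are null, hence so is `c` modulo the union. -/
theorem Connects.null {A B : Set X} {k : ℕ} {c : Chain X (k + 2)} {a : Chain X (k + 1)}
    (h : Connects A B c a) (hA : Vanishes A (k + 1)) (hB : Vanishes B (k + 1))
    (ha : Null (A ∩ B) a) : Null (A ∪ B) c := by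
  obtain ⟨haA, e, he, h⟩ := h
  obtain ⟨d, hd⟩ := ha
  have hdA : RelCycle A d := by
    have := Submodule.add_mem _ haA (chainsIn_mono Set.inter_subset_left _ hd)
    rwa [← add_assoc, add_self_eq_zero, zero_add] at this
  have hcB : RelCycle B (c + e + d) := by
    have := Submodule.add_mem _ h (chainsIn_mono Set.inter_subset_right _ hd)
    rw [RelCycle, map_add]
    rwa [add_assoc, ← add_assoc a, add_self_eq_zero, zero_add] at this
  have h1 := ((hB _ hcB).mono Set.subset_union_right).of_add
    ((hA _ hdA).mono (Set.subset_union_left (t := B)))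
  exact h1.of_add (null_of_mem he)

theorem Vanishes.union {A B : Set X} (hA : IsOpen A) (hB : IsOpen B) {k : ℕ}
    (hvA : Vanishes A (k + 1)) (hvB : Vanishes B (k + 1)) (h : Vanishes (A ∩ B) k) :
    Vanishes (A ∪ B) (k + 1) := fun c hc => by
  obtain ⟨a, hca, ha⟩ := exists_connects hA hB hc
  exact hca.null hvA hvB (h a ha)

theorem AtMostOneClass.union {A B : Set X} (hA : IsOpen A) (hB : IsOpen B) {k : ℕ}
    (hvA : Vanishes A (k + 1)) (hvB : Vanishes B (k + 1)) (h : AtMostOneClass (A ∩ B) k) :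
    AtMostOneClass (A ∪ B) (k + 1) := fun c c' hc hc' hn hn' => by
  obtain ⟨a, hca, ha⟩ := exists_connects hA hB hc
  obtain ⟨a', hca', ha'⟩ := exists_connects hA hB hc'
  exact (hca.add hca').null hvA hvB (h a a' ha ha' (fun h => hn (hca.null hvA hvB h))
    fun h => hn' (hca'.null hvA hvB h))

/-- Another piece of Mayer-Vietoris: a class that dies modulo `A` and modulo `B` comes from degree
`k + 1` modulo `A ∪ B`, where homology vanishes. In chains, `d₁ + d₂` is a cycle modulo the union;
after adding a boundary it splits, and the pieces correct `d₁` and `d₂`. -/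
theorem null_inter {A B : Set X} (hA : IsOpen A) (hB : IsOpen B) {k : ℕ} {c : Chain X (k + 1)}
    (hcA : Null A c) (hcB : Null B c) (h : Vanishes (A ∪ B) (k + 1)) : Null (A ∩ B) c := by
  obtain ⟨d₁, h₁⟩ := hcA
  obtain ⟨d₂, h₂⟩ := hcB
  have hx : bd (d₁ + d₂) = (c + bd d₁) + (c + bd d₂) := by
    rw [map_add]
    abel_nf
    simp [two_zsmul_eq_zero]
  obtain ⟨g, hg⟩ := h (d₁ + d₂) (by
    rw [RelCycle, hx]
    exact Submodule.add_mem _ (chainsIn_mono Set.subset_union_left _ h₁)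
      (chainsIn_mono Set.subset_union_right _ h₂))
  obtain ⟨T, T', -, hT', a, ha, b, hb, hab⟩ := exists_split hA hB hg
  have hbd : bd (d₁ + d₂ + bd g) = (c + bd d₁) + (c + bd d₂) := by
    rw [map_add, bd_bd, add_zero, hx]
  rw [hbd, map_add] at hab
  have e := congrArg bd hab
  simp only [map_add, bd_bd, add_zero] at e
  have hA' := Submodule.add_mem _ h₁ (bd_mem (Submodule.add_mem _ ha (hT' _ _ h₁)))
  have hB' := Submodule.add_mem _ h₂ (bd_mem (Submodule.add_mem _ hb (hT' _ _ h₂)))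
  -- The left side lies in `A` and the right side in `B`.
  have key : (c + bd d₁) + bd (a + T' (c + bd d₁)) = (c + bd d₂) + bd (b + T' (c + bd d₂)) := by
    apply eq_of_add_eq_zero
    simp only [map_add]
    linear_combination (norm := (abel_nf; simp [two_zsmul_eq_zero])) e
  refine ⟨d₁ + (a + T' (c + bd d₁)), ?_⟩
  rw [map_add, ← add_assoc]
  exact mem_chainsIn_inter hA' (by rw [key]; exact hB')

/-- The homology of `X` modulo `Kᶜ` vanishes above degree `m`, and its classes in degree `m` are
detected at the points of `K`. -/
structure Detected (m : ℕ) (K : Set X) : Prop where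
  vanishes : ∀ k, m < k → Vanishes Kᶜ k
  null : ∀ c : Chain X (m + 1), RelCycle Kᶜ c → (∀ x ∈ K, Null {x}ᶜ c) → Null Kᶜ c

theorem detected_empty (m : ℕ) : Detected m (∅ : Set X) := by
  have (k : ℕ) (c : Chain X (k + 1)) : Null (∅ᶜ : Set X) c :=
    null_of_mem (by rw [Set.compl_empty, chainsIn_univ]; trivial)
  exact ⟨fun _ _ _ _ => this _ _, fun _ _ _ => this _ _⟩

/-- `null_inter` for the two complements; its vanishing hypothesis, one degree up, is the vanishing
part of `dKL`. -/
theorem Detected.union {m : ℕ} {K L : Set X} (hK : IsClosed K) (hL : IsClosed L)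
    (dK : Detected m K) (dL : Detected m L) (dKL : Detected m (K ∩ L)) : Detected m (K ∪ L) := by
  have hv (k : ℕ) (hk : m ≤ k) : Vanishes (Kᶜ ∪ Lᶜ) (k + 1) := by
    rw [← Set.compl_inter]
    exact dKL.vanishes _ (Nat.lt_succ_of_le hk)
  constructor
  · intro k hk c hc
    rw [Set.compl_union] at hc ⊢
    exact null_inter hK.isOpen_compl hL.isOpen_compl
      (dK.vanishes k hk c (hc.mono Set.inter_subset_left))
      (dL.vanishes k hk c (hc.mono Set.inter_subset_right)) (hv k hk.le)
  · intro c hc hx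
    rw [Set.compl_union] at hc ⊢
    exact null_inter hK.isOpen_compl hL.isOpen_compl
      (dK.null c (hc.mono Set.inter_subset_left) fun x h => hx x (Or.inl h))
      (dL.null c (hc.mono Set.inter_subset_right) fun x h => hx x (Or.inr h)) (hv m le_rfl)

theorem detected_biUnion {m : ℕ} (P : Set X → Prop) (hP : ∀ K, P K → IsClosed K ∧ Detected m K)
    (hPi : ∀ K L, P K → P L → P (K ∩ L)) {ι : Type*} (s : Finset ι) (f : ι → Set X)
    (hf : ∀ i, P (f i)) : Detected m (⋃ i ∈ s, f i) := by
  classical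
  induction s using Finset.induction_on generalizing f with
  | empty => simpa using detected_empty m
  | insert a s _ ih =>
    rw [Finset.set_biUnion_insert]
    refine (hP _ (hf a)).2.union (hP _ (hf a)).1
      (isClosed_biUnion_finset fun i _ => (hP _ (hf i)).1) (ih f hf) ?_
    -- The intersection is again a union over `s`, of the sets `f a ∩ f i`; hence `f` is generalized
    -- and `P` is stable under intersections.
    rw [Set.inter_iUnion₂]
    exact ih _ fun i => hPi _ _ (hf a) (hf i)

/-- Chains have compact support. -/
theorem exists_isCompact_mem {A : Set X} {k : ℕ} {c : Chain X k} (hc : c ∈ chainsIn A k) :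
    ∃ C ⊆ A, IsCompact C ∧ c ∈ chainsIn C k := by
  refine ⟨⋃ σ ∈ c.support, Set.range σ, Set.iUnion₂_subset fun σ hσ => hc hσ,
    c.support.isCompact_biUnion fun σ _ => isCompact_range σ.continuous, fun σ hσ => ?_⟩
  exact Set.subset_biUnion_of_mem (u := fun σ : C(Simplex k, X) => Set.range σ) hσ

end Relative

section Euclidean

variable {m : ℕ}

/-! ### Local homology of Euclidean space -/

/-- The straight homotopy from the identity to a constant map. -/
def straightHomotopy {V : Type*} [AddCommGroup V] [Module ℝ V] [TopologicalSpace V]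
    [ContinuousAdd V] [ContinuousSMul ℝ V] (p : V) :
    (ContinuousMap.id V).Homotopy (ContinuousMap.const V p) where
  toFun x := (1 - (x.1 : ℝ)) • x.2 + (x.1 : ℝ) • p
  continuous_toFun := by fun_prop
  map_zero_left x := by simp
  map_one_left x := by simp

theorem bd_const {X : Type*} [TopologicalSpace X] (p : X) (k : ℕ) :
    bd (Finsupp.single (ContinuousMap.const (Simplex (k + 1)) p) 1) =
      ((k + 1 : ℕ) : ZMod 2) • Finsupp.single (ContinuousMap.const (Simplex k) p) 1 := by
  rw [bd_single, Nat.cast_smul_eq_nsmul]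
  change ∑ _i : Fin (k + 1), Finsupp.single (ContinuousMap.const (Simplex k) p) (1 : ZMod 2) = _
  rw [Finset.sum_const, Finset.card_univ, Fintype.card_fin]

theorem push_const {X : Type*} [TopologicalSpace X] (p : X) {k : ℕ} (c : Chain X k) :
    ∃ a : ZMod 2, push (ContinuousMap.const X p) c =
      a • Finsupp.single (ContinuousMap.const (Simplex k) p) 1 := by
  have : push (ContinuousMap.const X p) c ∈ Submodule.span (ZMod 2)
      {Finsupp.single (ContinuousMap.const (Simplex k) p) (1 : ZMod 2)} := by
    refine map_mem_of_single (s := Set.univ) _ _ (fun σ _ => ?_) (by simp)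
    rw [push_single]
    exact Submodule.mem_span_singleton_self _
  obtain ⟨a, ha⟩ := Submodule.mem_span_singleton.1 this
  exact ⟨a, ha.symm⟩

theorem zmod_two_eq (a : ZMod 2) : a = 0 ∨ a = 1 := by
  revert a
  decide

/-- The contraction turns `c` into a multiple of the constant `k`-simplex, and parity decides: for
`k` even that simplex is not a cycle, for `k` odd it is the boundary of the constant `(k +
1)`-simplex. -/
theorem vanishes_empty {X : Type*} [TopologicalSpace X] {p : X}
    (H : (ContinuousMap.id X).Homotopy (ContinuousMap.const X p)) {k : ℕ} (hk : 0 < k) :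
    Vanishes (∅ : Set X) k := fun c hc => by
  have h1 := null_push_add_push (B := ∅) H (fun _ _ h => h.elim) hc
  rw [push_id] at h1
  refine h1.of_add ?_
  obtain ⟨a, ha⟩ := push_const p c
  rw [ha]
  rcases Nat.even_or_odd k with he | ho
  · obtain ⟨k, rfl⟩ := Nat.exists_eq_succ_of_ne_zero hk.ne'
    have h2 := congrArg bd ha
    rw [bd_push, chainsIn_empty hc, map_zero, map_smul, bd_const,
      ZMod.natCast_eq_one_iff_odd.2 he.add_one, one_smul] at h2
    have h3 := DFunLike.congr_fun h2 (ContinuousMap.const (Simplex (k + 1)) p)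
    simp only [Finsupp.smul_apply, Finsupp.single_eq_same, Finsupp.coe_zero, Pi.zero_apply,
      smul_eq_mul, mul_one] at h3
    rw [← h3, zero_smul]
    exact null_of_mem (Submodule.zero_mem _)
  · have h2 := bd_const p (k + 1)
    rw [ZMod.natCast_eq_one_iff_odd.2 (by simpa using ho.add_one.add_one), one_smul] at h2
    rw [← h2, ← map_smul]
    exact null_bd _

/-- Every class that is not null is the class of the constant `0`-simplex at `p`. -/
theorem atMostOneClass_empty {X : Type*} [TopologicalSpace X] {p : X}
    (H : (ContinuousMap.id X).Homotopy (ContinuousMap.const X p)) :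
    AtMostOneClass (∅ : Set X) 0 := fun c c' hc hc' hn hn' => by
  have key (c : Chain X 1) (hc : RelCycle ∅ c) (hn : ¬ Null ∅ c) :
      Null ∅ (c + Finsupp.single (ContinuousMap.const (Simplex 1) p) 1) := by
    have h1 := null_push_add_push (B := ∅) H (fun _ _ h => h.elim) hc
    rw [push_id] at h1
    obtain ⟨a, ha⟩ := push_const p c
    rw [ha] at h1
    rcases zmod_two_eq a with rfl | rfl
    · rw [zero_smul, add_zero] at h1
      exact absurd h1 hn
    · rwa [one_smul] at h1
  have := (key c hc hn).add (key c' hc' hn')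
  rwa [add_add_add_comm, add_self_eq_zero, add_zero] at this

/-- The affine subspace through `x` on which the first `j` coordinates are constant. -/
def coordPlane (x : EuclideanSpace ℝ (Fin m)) (j : ℕ) : Set (EuclideanSpace ℝ (Fin m)) :=
  {y | ∀ i : Fin m, i.1 < j → y i = x i}

/-- A half-space of `coordPlane x j` bounded by `coordPlane x (j + 1)`. -/
def halfPlane (x : EuclideanSpace ℝ (Fin m)) (j : Fin m) (s : ℝ) :
    Set (EuclideanSpace ℝ (Fin m)) :=
  {y | y ∈ coordPlane x j ∧ 0 ≤ s * (y j - x j)}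

theorem isClosed_coordPlane (x : EuclideanSpace ℝ (Fin m)) (j : ℕ) :
    IsClosed (coordPlane x j) := by
  simp only [coordPlane, Set.ofPred_forall]
  exact isClosed_iInter fun i => isClosed_iInter fun _ => isClosed_eq (by fun_prop) (by fun_prop)

theorem isClosed_halfPlane (x : EuclideanSpace ℝ (Fin m)) (j : Fin m) (s : ℝ) :
    IsClosed (halfPlane x j s) :=
  (isClosed_coordPlane x j).inter
    (isClosed_le continuous_const (by fun_prop : Continuous fun y : EuclideanSpace ℝ (Fin m) =>
      s * (y j - x j)))

/-- The complement is star-shaped about `x - s e_j`, since `s = ±1` puts this point strictly on the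
other side. -/
theorem vanishes_compl_halfPlane (x : EuclideanSpace ℝ (Fin m)) (j : Fin m) {s : ℝ}
    (hs : s * s = 1) (k : ℕ) : Vanishes (halfPlane x j s)ᶜ k := by
  have hj (y : EuclideanSpace ℝ (Fin m)) (t : ℝ) :
      s * (((1 - t) • y + t • (x - EuclideanSpace.single j s)) j - x j) =
        (1 - t) * (s * (y j - x j)) - t := by
    simp
    linear_combination (-t) * hs
  refine vanishes_of_homotopy (A := (halfPlane x j s)ᶜ) (p := x - EuclideanSpace.single j s) ?_
    (straightHomotopy _) (fun t y hy hz => hy ?_) k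
  · intro h
    have := hj x 1
    have h2 := h.2
    simp at h2
    linarith
  · change (1 - (t : ℝ)) • y + (t : ℝ) • (x - EuclideanSpace.single j s) ∈ _ at hz
    have h2 := hz.2
    rw [hj] at h2
    have ht0 := t.2.1
    have ht : (t : ℝ) < 1 := by
      refine lt_of_le_of_ne t.2.2 fun h => ?_
      rw [h] at h2
      linarith
    refine ⟨fun i hi => ?_, ?_⟩
    · have h1 := hz.1 i hi
      have hij : i ≠ j := fun h => by simp [h] at hi
      simp [hij] at h1
      have : (1 - (t : ℝ)) * (y i - x i) = 0 := by linear_combination h1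
      rcases mul_eq_zero.1 this with h | h <;> linarith
    · by_contra hneg
      push Not at hneg
      nlinarith

theorem compl_halfPlane_inter (x : EuclideanSpace ℝ (Fin m)) (j : Fin m) :
    (halfPlane x j 1)ᶜ ∩ (halfPlane x j (-1))ᶜ = (coordPlane x j)ᶜ := by
  rw [← Set.compl_union]
  congr 1
  ext y
  constructor
  · rintro (h | h) <;> exact h.1
  · intro h
    rcases le_total (x j) (y j) with h' | h'
    · exact Or.inl ⟨h, by linarith⟩
    · exact Or.inr ⟨h, by linarith⟩

theorem compl_halfPlane_union (x : EuclideanSpace ℝ (Fin m)) (j : Fin m) :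
    (halfPlane x j 1)ᶜ ∪ (halfPlane x j (-1))ᶜ = (coordPlane x (j + 1))ᶜ := by
  rw [← Set.compl_inter]
  congr 1
  ext y
  constructor
  · rintro ⟨⟨h, h1⟩, -, h2⟩ i hi
    rcases Nat.lt_succ_iff_lt_or_eq.1 hi with hi | hi
    · exact h i hi
    · obtain rfl := Fin.ext hi
      linarith
  · intro h
    have hj := h j (Nat.lt_succ_self _)
    exact ⟨⟨fun i hi => h i (hi.trans (Nat.lt_succ_self _)), by rw [hj]; simp⟩,
      fun i hi => h i (hi.trans (Nat.lt_succ_self _)), by rw [hj]; simp⟩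

/-- Dimension shifting. The complements of two opposite half-planes have vanishing relative
homology, meet in the complement of `coordPlane x j` and cover that of `coordPlane x (j + 1)`. The
induction starts from the whole space and reaches the point `x` at `j = m`. -/
theorem coordPlane_homology (x : EuclideanSpace ℝ (Fin m)) (j : ℕ) (hj : j ≤ m) :
    (∀ k, j < k → Vanishes (coordPlane x j)ᶜ k) ∧ AtMostOneClass (coordPlane x j)ᶜ j := by
  induction j with
  | zero =>
    have : (coordPlane x 0)ᶜ = ∅ := by simp [coordPlane]
    rw [this]
    exact ⟨fun k hk => vanishes_empty (straightHomotopy x) hk,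
      atMostOneClass_empty (straightHomotopy x)⟩
  | succ j ih =>
    obtain ⟨h1, h2⟩ := ih (by lia)
    have e1 := compl_halfPlane_inter x ⟨j, hj⟩
    have e2 := compl_halfPlane_union x ⟨j, hj⟩
    simp only at e1 e2
    have o (s : ℝ) := (isClosed_halfPlane x ⟨j, hj⟩ s).isOpen_compl
    have v (s : ℝ) (hs : s * s = 1) (k : ℕ) := vanishes_compl_halfPlane x ⟨j, hj⟩ hs k
    rw [← e2]
    rw [← e1] at h1 h2
    refine ⟨fun k hk => ?_, .union (o _) (o _) (v _ (by norm_num) _) (v _ (by norm_num) _) h2⟩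
    obtain ⟨k, rfl⟩ := Nat.exists_eq_succ_of_ne_zero (Nat.ne_zero_of_lt hk)
    exact .union (o _) (o _) (v _ (by norm_num) _) (v _ (by norm_num) _) (h1 k (by lia))

theorem coordPlane_self (x : EuclideanSpace ℝ (Fin m)) : coordPlane x m = {x} := by
  ext y
  exact ⟨fun h => PiLp.ext fun i => h i i.2, fun h i _ => by rw [Set.mem_singleton_iff.1 h]⟩

theorem vanishes_compl_singleton (x : EuclideanSpace ℝ (Fin m)) {k : ℕ} (hk : m < k) :
    Vanishes {x}ᶜ k := by
  rw [← coordPlane_self]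
  exact (coordPlane_homology x m le_rfl).1 k hk

theorem atMostOneClass_compl_singleton (x : EuclideanSpace ℝ (Fin m)) :
    AtMostOneClass {x}ᶜ m := by
  rw [← coordPlane_self]
  exact (coordPlane_homology x m le_rfl).2

/-! ### Compact subsets of Euclidean space -/

/-- The homotopy that stretches the space from the centre `x`. -/
def stretchHomotopy {V : Type*} [NormedAddCommGroup V] [NormedSpace ℝ V] (x : V) (N : ℝ) :
    (ContinuousMap.id V).Homotopy
      ⟨fun y => x + (1 + N) • (y - x), by fun_prop⟩ where
  toFun y := x + (1 + (y.1 : ℝ) * N) • (y.2 - x)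
  continuous_toFun := by fun_prop
  map_zero_left y := by simp
  map_one_left y := by simp

/-- The chain `c + bd d` lives in a compact set that misses `x`. A large stretching from `x` moves
that set off `K`, and no stretching moves a point outside `K` into `K`, because `K` is star-shaped
about `x`. -/
theorem null_compl_of_convex {V : Type*} [NormedAddCommGroup V] [NormedSpace ℝ V] {K : Set V}
    (hK : Convex ℝ K) (hKb : IsCompact K) {x : V} (hx : x ∈ K) {k : ℕ} {c : Chain V (k + 1)}
    (hc : RelCycle Kᶜ c) (hcx : Null {x}ᶜ c) : Null Kᶜ c := by
  obtain ⟨d, hd⟩ := hcx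
  obtain ⟨C, hCx, hC, hdC⟩ := exists_isCompact_mem hd
  obtain ⟨ε, hε, hball⟩ := Metric.isOpen_iff.1 hC.isClosed.isOpen_compl x fun h => hCx h rfl
  obtain ⟨R, hR⟩ := hKb.isBounded.subset_closedBall x
  -- Points at distance at least `ε` from `x` are thrown beyond the radius `R` of a ball containing
  -- `K`.
  obtain ⟨N, hN⟩ := exists_nat_gt (R / ε)
  rw [div_lt_iff₀ hε] at hN
  have hpres : ∀ s, ∀ y ∈ Kᶜ, stretchHomotopy x N (s, y) ∈ Kᶜ := by
    intro s y hy hz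
    apply hy
    change x + (1 + (s : ℝ) * N) • (y - x) ∈ K at hz
    have hs : (0 : ℝ) ≤ s * N := mul_nonneg s.2.1 (Nat.cast_nonneg _)
    have := hK.add_smul_sub_mem hx hz (t := (1 + (s : ℝ) * N)⁻¹)
      ⟨by positivity, inv_le_one_of_one_le₀ (by linarith)⟩
    rwa [add_sub_cancel_left, smul_smul, inv_mul_cancel₀ (by positivity), one_smul,
      add_sub_cancel] at this
  have hrel : RelCycle Kᶜ (c + bd d) := by
    rwa [RelCycle, map_add, bd_bd, add_zero]
  have h1 := null_push_add_push (stretchHomotopy x (N : ℝ)) hpres hrel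
  rw [push_id] at h1
  refine (h1.of_add (null_of_mem (push_mem (fun y hy hyK => ?_) hdC))).of_add (null_bd d)
  have hy1 : ε ≤ dist y x := by
    by_contra h
    exact hball (Metric.mem_ball.2 (not_le.1 h)) hy
  have hy2 := hR hyK
  rw [Metric.mem_closedBall, ContinuousMap.coe_mk, dist_eq_norm, add_sub_cancel_left, norm_smul,
    ← dist_eq_norm, Real.norm_of_nonneg (by positivity)] at hy2
  nlinarith [(Nat.cast_nonneg N : (0 : ℝ) ≤ N)]

theorem detected_of_convex {K : Set (EuclideanSpace ℝ (Fin m))} (hK : Convex ℝ K)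
    (hKc : IsCompact K) : Detected m K := by
  rcases K.eq_empty_or_nonempty with rfl | ⟨x, hx⟩
  · exact detected_empty m
  · refine ⟨fun k hk c hc => null_compl_of_convex hK hKc hx hc ?_,
      fun c hc h => null_compl_of_convex hK hKc hx hc (h x hx)⟩
    exact vanishes_compl_singleton x hk c
      (hc.mono (Set.compl_subset_compl.2 (Set.singleton_subset_iff.2 hx)))

/-- Finitely many closed balls centred in `K`, each missing `C` of its centre, cover `K`. Compact
convex sets are stable under intersection, so their union is detected. -/
theorem exists_detected_superset {K : Set (EuclideanSpace ℝ (Fin m))} (hK : IsCompact K)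
    (C : EuclideanSpace ℝ (Fin m) → Set (EuclideanSpace ℝ (Fin m)))
    (hC : ∀ x ∈ K, IsClosed (C x) ∧ x ∉ C x) :
    ∃ L, K ⊆ L ∧ Detected m L ∧ ∀ y ∈ L, ∃ x ∈ K, y ∉ C x := by
  have hr : ∀ x, ∃ r > 0, x ∈ K → Metric.closedBall x r ⊆ (C x)ᶜ := by
    intro x
    by_cases hx : x ∈ K
    · obtain ⟨r, hr, h⟩ := Metric.nhds_basis_closedBall.mem_iff.1
        ((hC x hx).1.isOpen_compl.mem_nhds (hC x hx).2)
      exact ⟨r, hr, fun _ => h⟩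
    · exact ⟨1, one_pos, fun h => absurd h hx⟩
  choose r hr0 hr using hr
  obtain ⟨t, htK, ht⟩ := hK.elim_nhds_subcover (fun x => Metric.closedBall x (r x))
    fun x _ => Metric.closedBall_mem_nhds x (hr0 x)
  refine ⟨_, ht, detected_biUnion (fun L => Convex ℝ L ∧ IsCompact L)
    (fun L hL => ⟨hL.2.isClosed, detected_of_convex hL.1 hL.2⟩)
    (fun L L' hL hL' => ⟨hL.1.inter hL'.1, hL.2.inter hL'.2⟩) _ _
    fun x => ⟨convex_closedBall _ _, isCompact_closedBall _ _⟩, fun y hy => ?_⟩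
  obtain ⟨x, hx, hy⟩ := Set.mem_iUnion₂.1 hy
  exact ⟨x, htK x hx, hr x (htK x hx) hy⟩

/-- Compact supports leave room to enlarge `K` to a finite union of balls `L`: the boundary of `c`
still avoids `L`, and a chain witnessing nullity at `x` does so at every point of a small ball
around `x`. -/
theorem detected_of_isCompact {K : Set (EuclideanSpace ℝ (Fin m))} (hK : IsCompact K) :
    Detected m K := by
  constructor
  · intro k hk c hc
    obtain ⟨C, hCK, hC, hcC⟩ := exists_isCompact_mem hc
    obtain ⟨L, hKL, hL, hLC⟩ := exists_detected_superset hK (fun _ => C)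
      fun x hx => ⟨hC.isClosed, fun h => hCK h hx⟩
    refine (hL.vanishes k hk c (chainsIn_mono (fun y hy hyL => ?_) _ hcC)).mono
      (Set.compl_subset_compl.2 hKL)
    obtain ⟨x, -, h⟩ := hLC y hyL
    exact h hy
  · intro c hc hx
    obtain ⟨C, hCK, hC, hcC⟩ := exists_isCompact_mem hc
    have hD : ∀ x, ∃ D : Set (EuclideanSpace ℝ (Fin m)), x ∈ K → IsCompact D ∧ x ∉ D ∧
        ∃ d, c + bd d ∈ chainsIn D (m + 1) := by
      intro x
      by_cases hxK : x ∈ K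
      · obtain ⟨d, hd⟩ := hx x hxK
        obtain ⟨D, hDx, hD, hdD⟩ := exists_isCompact_mem hd
        exact ⟨D, fun _ => ⟨hD, fun h => hDx h rfl, d, hdD⟩⟩
      · exact ⟨∅, fun h => absurd h hxK⟩
    choose D hD using hD
    obtain ⟨L, hKL, hL, hLC⟩ := exists_detected_superset hK (fun x => C ∪ D x)
      fun x hx => ⟨hC.isClosed.union (hD x hx).1.isClosed, fun h =>
        h.elim (fun h => hCK h hx) (hD x hx).2.1⟩
    refine (hL.null c (chainsIn_mono (fun y hy hyL => ?_) _ hcC) fun y hy => ?_).mono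
      (Set.compl_subset_compl.2 hKL)
    · obtain ⟨x, -, h⟩ := hLC y hyL
      exact h (Or.inl hy)
    · obtain ⟨x, hxK, h⟩ := hLC y hy
      obtain ⟨-, -, d, hd⟩ := hD x hxK
      exact ⟨d, chainsIn_mono (fun z hz (e : z = y) => h (Or.inr (e ▸ hz))) _ hd⟩

end Euclidean

section Embedding

variable {X Y : Type*} [TopologicalSpace X] [TopologicalSpace Y]

/-! ### Excision along open embeddings -/

theorem exists_push_eq {j : C(X, Y)} (hj : Topology.IsEmbedding j) {k : ℕ} {c : Chain Y k}
    (hc : c ∈ chainsIn (Set.range j) k) : ∃ c', push j c' = c := by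
  refine map_mem_of_single LinearMap.id (LinearMap.range (push j)) (fun σ hσ => ?_) hc
  refine ⟨Finsupp.single ((⟨hj.toHomeomorph.symm, hj.toHomeomorph.symm.continuous⟩ : C(_, X)).comp
    ⟨fun t => ⟨σ t, hσ ⟨t, rfl⟩⟩, by fun_prop⟩) 1, ?_⟩
  rw [push_single]
  congr 1
  ext t
  exact congrArg Subtype.val (hj.toHomeomorph.apply_symm_apply ⟨σ t, hσ ⟨t, rfl⟩⟩)

theorem mem_of_push_mem {j : C(X, Y)} (hj : Function.Injective j) {B : Set Y} {k : ℕ}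
    {c : Chain X k} (hc : push j c ∈ chainsIn B k) : c ∈ chainsIn (j ⁻¹' B) k := by
  classical
  have hinj : Function.Injective fun σ : C(Simplex k, X) => j.comp σ := fun σ τ h => by
    ext t
    exact hj (DFunLike.congr_fun h t)
  intro σ hσ
  have : j.comp σ ∈ (push j c).support := by
    change _ ∈ (Finsupp.mapDomain _ c).support
    rw [Finsupp.mapDomain_support_of_injective hinj]
    exact Finset.mem_image_of_mem _ hσ
  have hr : Set.range (j.comp σ) ⊆ B := hc this
  rintro _ ⟨t, rfl⟩
  exact hr (Set.mem_range_self t)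

theorem push_mem_range (j : C(X, Y)) {k : ℕ} (c : Chain X k) :
    push j c ∈ chainsIn (Set.range j) k :=
  push_mem (A := Set.univ) (fun x _ => Set.mem_range_self x) (by rw [chainsIn_univ]; trivial)

/-- Injectivity in excision: split the bounding chain `d`, and pull back the part in the range of
`j` together with its correction `T' (push j c)`. -/
theorem Null.of_push {j : C(X, Y)} (hj : Topology.IsOpenEmbedding j) {B : Set Y} (hB : IsOpen B)
    (hjB : Set.range j ∪ B = Set.univ) {k : ℕ} {c : Chain X (k + 1)} (h : Null B (push j c)) :
    Null (j ⁻¹' B) c := by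
  obtain ⟨d, hd⟩ := h
  obtain ⟨T, T', -, hT', a, ha, b, hb, hab⟩ := exists_split hj.isOpen_range hB
    (c := d) (by rw [hjB, chainsIn_univ]; trivial)
  have ha' := Submodule.add_mem _ ha (hT' _ _ (push_mem_range j c))
  obtain ⟨d', hd'⟩ := exists_push_eq hj.isEmbedding ha'
  refine ⟨d', mem_of_push_mem hj.injective ?_⟩
  have e := congrArg bd hab
  have key : push j (c + bd d') = (push j c + bd d) + bd (b + T' (push j c + bd d)) := by
    rw [map_add, ← bd_push, hd']
    simp only [map_add, bd_bd, add_zero] at e ⊢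
    linear_combination (norm := (abel_nf; simp [two_zsmul_eq_zero])) -e
  rw [key]
  exact Submodule.add_mem _ hd (bd_mem (Submodule.add_mem _ hb (hT' _ _ hd)))

/-- Excision: by splitting, every cycle modulo `Kᶜ` is homologous to one pushed forward from `X`. -/
theorem Detected.of_isOpenEmbedding {m : ℕ} {j : C(X, Y)} (hj : Topology.IsOpenEmbedding j)
    [T1Space Y] {K : Set Y} (hK : IsClosed K) (hKj : K ⊆ Set.range j)
    (h : Detected m (j ⁻¹' K)) : Detected m K := by
  have hcov : Set.range j ∪ Kᶜ = Set.univ := by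
    rw [Set.eq_univ_iff_forall]
    intro y
    by_cases hy : y ∈ K
    · exact Or.inl (hKj hy)
    · exact Or.inr hy
  have key {k : ℕ} (c : Chain Y (k + 1)) (hc : RelCycle Kᶜ c) : ∃ c' : Chain X (k + 1),
      RelCycle (j ⁻¹' K)ᶜ c' ∧ Null Kᶜ (c + push j c') := by
    obtain ⟨T, T', -, hT', a, ha, b, hb, hab⟩ := exists_split hj.isOpen_range hK.isOpen_compl
      (c := c) (by rw [hcov, chainsIn_univ]; trivial)
    obtain ⟨c', rfl⟩ := exists_push_eq hj.isEmbedding ha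
    have hn : Null Kᶜ (c + push j c') := by
      have e : c + push j c' = bd (T c) + (b + T' (bd c)) := by
        linear_combination (norm := (abel_nf; simp [two_zsmul_eq_zero])) hab
      rw [e]
      exact (null_bd _).add (null_of_mem (Submodule.add_mem _ hb (hT' _ _ hc)))
    refine ⟨c', mem_of_push_mem hj.injective (B := Kᶜ) ?_, hn⟩
    rw [← bd_push]
    obtain ⟨d, hd⟩ := hn
    have := Submodule.add_mem _ (bd_mem hd) hc
    rw [map_add, bd_bd, add_zero, map_add] at this
    convert this using 1
    abel_nf
    simp [two_zsmul_eq_zero]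
  have hpush {k : ℕ} {c : Chain Y (k + 1)} {c' : Chain X (k + 1)} (hcc' : Null Kᶜ (c + push j c'))
      (hc' : Null (j ⁻¹' K)ᶜ c') : Null Kᶜ c :=
    hcc'.of_add (hc'.map fun _ hx => hx)
  constructor
  · intro k hk c hc
    obtain ⟨c', hc', hcc'⟩ := key c hc
    exact hpush hcc' (h.vanishes k hk c' hc')
  · intro c hc hx
    obtain ⟨c', hc', hcc'⟩ := key c hc
    refine hpush hcc' (h.null c' hc' fun x hxK => ?_)
    have h1 : Null {j x}ᶜ (push j c') := by
      have : Null {j x}ᶜ (c + push j c') := hcc'.mono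
        (Set.compl_subset_compl.2 (Set.singleton_subset_iff.2 (show j x ∈ K from hxK)))
      rw [add_comm] at this
      exact this.of_add (hx _ hxK)
    have h2 := h1.of_push hj isOpen_compl_singleton (by
      rw [Set.eq_univ_iff_forall]
      intro y
      by_cases hy : y = j x
      · exact Or.inl ⟨x, hy.symm⟩
      · exact Or.inr hy)
    exact h2.mono fun z (hz : j z ≠ j x) hzx => hz (congrArg j hzx)

/-! ### Closed manifolds -/

/-- Every point lies in the image of an open embedding of `ℝᵐ`. -/
def LocallyEuclidean (m : ℕ) (X : Type*) [TopologicalSpace X] : Prop :=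
  ∀ x : X, ∃ j : C(EuclideanSpace ℝ (Fin m), X), Topology.IsOpenEmbedding j ∧ x ∈ Set.range j

theorem exists_isOpenEmbedding_subset {m : ℕ} {x : X} {U : Set X} (hU : U ∈ nhds x)
    (j : C(EuclideanSpace ℝ (Fin m), X)) (hj : Topology.IsOpenEmbedding j) (hx : x ∈ Set.range j) :
    ∃ i : C(EuclideanSpace ℝ (Fin m), X), Topology.IsOpenEmbedding i ∧ x ∈ Set.range i ∧
      Set.range i ⊆ U := by
  obtain ⟨p, rfl⟩ := hx
  obtain ⟨r, hr, hball⟩ := Metric.mem_nhds_iff.1 (j.continuous.continuousAt.preimage_mem_nhds hU)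
  have hu : Topology.IsOpenEmbedding (OpenPartialHomeomorph.univBall p r) :=
    (OpenPartialHomeomorph.univBall p r).isOpenEmbedding (by simp)
  refine ⟨j.comp ⟨_, hu.continuous⟩, hj.comp hu, ⟨0, by simp⟩, ?_⟩
  rintro _ ⟨y, rfl⟩
  refine hball ?_
  rw [← OpenPartialHomeomorph.univBall_target p hr]
  exact (OpenPartialHomeomorph.univBall p r).map_source (by simp)

theorem locallyEuclidean_of_chartedSpace (m : ℕ) (M : Type*) [TopologicalSpace M]
    [ChartedSpace (EuclideanSpace ℝ (Fin m)) M] : LocallyEuclidean m M := fun x => by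
  set e := chartAt (EuclideanSpace ℝ (Fin m)) x
  obtain ⟨r, hr, hball⟩ := Metric.isOpen_iff.1 e.open_target (e x)
    (e.map_source (mem_chart_source _ x))
  set u := (OpenPartialHomeomorph.univBall (e x) r).trans e.symm
  have hs : u.source = Set.univ := by
    rw [Set.eq_univ_iff_forall]
    intro y
    refine ⟨by simp, hball ?_⟩
    rw [← OpenPartialHomeomorph.univBall_target (e x) hr]
    exact (OpenPartialHomeomorph.univBall (e x) r).map_source (by simp)
  have hu := u.isOpenEmbedding hs
  refine ⟨⟨u, hu.continuous⟩, hu, 0, ?_⟩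
  simp [u, e]

/-- Finitely many chart balls cover `X`. Compact subsets of charts are detected and stable under
intersection. Since `univᶜ = ∅`, the result concerns absolute homology. -/
theorem detected_univ {m : ℕ} [T2Space X] [CompactSpace X] (hX : LocallyEuclidean m X) :
    Detected m (Set.univ : Set X) := by
  choose j hj hjx using hX
  choose p hp using hjx
  obtain ⟨t, -, ht⟩ := (isCompact_univ (X := X)).elim_nhds_subcover
    (fun x => j x '' Metric.closedBall (p x) 1) (fun x _ => by
      have := (hj x).isOpenMap.image_mem_nhds (Metric.closedBall_mem_nhds (p x) one_pos)
      rwa [hp] at this)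
  rw [← Set.univ_subset_iff.1 ht]
  refine detected_biUnion (fun K => IsCompact K ∧ ∃ x, K ⊆ Set.range (j x))
    (fun K hK => ⟨hK.1.isClosed, ?_⟩)
    (fun K L hK hL => ⟨hK.1.inter hL.1, hK.2.imp fun _ h => Set.inter_subset_left.trans h⟩) _ _
    fun x => ⟨(isCompact_closedBall _ _).image (j x).continuous, x, Set.image_subset_range _ _⟩
  obtain ⟨hK, x, hx⟩ := hK
  exact .of_isOpenEmbedding (hj x) hK.isClosed hx
    (detected_of_isCompact (((hj x).isInducing.isCompact_preimage_iff hx).2 hK))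

end Embedding

/-! ### Quotients by free involutions -/

section Involution

variable {M : Type u} [TopologicalSpace M] (φ : M ≃ₜ M) (hφ : ∀ p, φ (φ p) = p)

/-- The orbit relation of an involution. -/
def involutionSetoid : Setoid M where
  r x y := y = x ∨ y = φ x
  iseqv :=
    { refl := fun _ => Or.inl rfl
      symm := by
        rintro x y (rfl | rfl)
        · exact Or.inl rfl
        · exact Or.inr (hφ x).symm
      trans := by
        rintro x y z (rfl | rfl) (rfl | rfl)
        · exact Or.inl rfl
        · exact Or.inr rfl
        · exact Or.inr rfl
        · exact Or.inl (hφ x) }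

/-- The orbit space of an involution. -/
abbrev InvolutionQuotient : Type u := Quotient (involutionSetoid φ hφ)

/-- The projection to the orbit space. -/
def involutionMk : C(M, InvolutionQuotient φ hφ) := ⟨Quotient.mk _, continuous_quotient_mk'⟩

theorem involutionMk_eq_iff {x y : M} :
    involutionMk φ hφ x = involutionMk φ hφ y ↔ y = x ∨ y = φ x :=
  Quotient.eq (r := involutionSetoid φ hφ)

theorem involutionMk_apply (x : M) : involutionMk φ hφ (φ x) = involutionMk φ hφ x :=
  ((involutionMk_eq_iff φ hφ).2 (Or.inr rfl)).symm

theorem isOpenQuotientMap_involutionMk : IsOpenQuotientMap (involutionMk φ hφ) := by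
  refine ⟨Quotient.mk_surjective, (involutionMk φ hφ).continuous, fun U hU => ?_⟩
  change IsOpen (Quotient.mk _ ⁻¹' _)
  have : Quotient.mk (involutionSetoid φ hφ) ⁻¹' (involutionMk φ hφ '' U) = U ∪ φ ⁻¹' U := by
    ext x
    constructor
    · rintro ⟨y, hy, hyx⟩
      rcases (involutionMk_eq_iff φ hφ).1 hyx with rfl | rfl
      · exact Or.inl hy
      · exact Or.inr (by rwa [Set.mem_preimage, hφ])
    · rintro (hx | hx)
      · exact ⟨x, hx, rfl⟩
      · exact ⟨φ x, hx, involutionMk_apply φ hφ x⟩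
  rw [this]
  exact hU.union (hU.preimage φ.continuous)

theorem t2Space_involutionQuotient [T2Space M] : T2Space (InvolutionQuotient φ hφ) := by
  rw [t2Space_iff_of_isOpenQuotientMap (isOpenQuotientMap_involutionMk φ hφ)]
  have : {q : M × M | involutionMk φ hφ q.1 = involutionMk φ hφ q.2} =
      {q | q.2 = q.1} ∪ {q | q.2 = φ q.1} := by
    ext q
    exact involutionMk_eq_iff φ hφ
  rw [this]
  exact (isClosed_eq continuous_snd continuous_fst).union
    (isClosed_eq continuous_snd (φ.continuous.comp continuous_fst))

variable {φ} [T2Space M]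

/-- Separate `x` from `φ x` and shrink a chart at `x` so that it is disjoint from its image; the
projection is then injective on it. -/
theorem exists_evenly_covered (hφ : ∀ p, φ (φ p) = p)
    (hfree : ∀ p, φ p ≠ p) {m : ℕ} (hM : LocallyEuclidean m M) (x : M) :
    ∃ j : C(EuclideanSpace ℝ (Fin m), M), Topology.IsOpenEmbedding j ∧ x ∈ Set.range j ∧
      Disjoint (Set.range j) (φ '' Set.range j) ∧
      Topology.IsOpenEmbedding ((involutionMk φ hφ).comp j) := by
  obtain ⟨j, hj, hx⟩ := hM x
  obtain ⟨U, V, hU, hV, hxU, hxV, hUV⟩ := t2_separation (hfree x).symm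
  have hW : U ∩ φ ⁻¹' V ∈ nhds x :=
    Filter.inter_mem (hU.mem_nhds hxU) ((hV.preimage φ.continuous).mem_nhds hxV)
  obtain ⟨i, hi, hxi, hiW⟩ := exists_isOpenEmbedding_subset hW j hj hx
  have hd : Disjoint (Set.range i) (φ '' Set.range i) := by
    refine hUV.mono (hiW.trans Set.inter_subset_left) ?_
    rintro _ ⟨y, hy, rfl⟩
    exact (hiW hy).2
  refine ⟨i, hi, hxi, hd, .of_continuous_injective_isOpenMap (by fun_prop) (fun a b hab => ?_)
    ((isOpenQuotientMap_involutionMk φ hφ).isOpenMap.comp hi.isOpenMap)⟩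
  rcases (involutionMk_eq_iff φ hφ).1 hab with h | h
  · exact hi.injective h.symm
  · exact absurd ⟨i a, ⟨a, rfl⟩, h.symm⟩ (Set.disjoint_left.1 hd ⟨b, rfl⟩)

theorem locallyEuclidean_involutionQuotient (hφ : ∀ p, φ (φ p) = p)
    (hfree : ∀ p, φ p ≠ p) {m : ℕ} (hM : LocallyEuclidean m M) :
    LocallyEuclidean m (InvolutionQuotient φ hφ) := fun y => by
  obtain ⟨x, rfl⟩ := Quotient.mk_surjective y
  obtain ⟨j, -, ⟨p, rfl⟩, -, hj⟩ := exists_evenly_covered hφ hfree hM x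
  exact ⟨_, hj, p, rfl⟩

/-- The projection to the orbit space has degree zero mod 2 at every point. -/
theorem null_push_involutionMk (hφ : ∀ p, φ (φ p) = p)
    (hfree : ∀ p, φ p ≠ p) {m : ℕ} (hM : LocallyEuclidean m M) {c : Chain M (m + 1)}
    (hc : RelCycle ∅ c) (hx : ∀ x, ¬ Null {x}ᶜ c) (x : M) :
    Null {involutionMk φ hφ x}ᶜ (push (involutionMk φ hφ) c) := by
  set q := involutionMk φ hφ
  obtain ⟨j, hj, ⟨p, rfl⟩, hd, -⟩ := exists_evenly_covered hφ hfree hM x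
  -- The second sheet over the same neighbourhood, parametrized so that `q ∘ i = q ∘ j`.
  set i : C(EuclideanSpace ℝ (Fin m), M) := (φ : C(M, M)).comp j
  have hi : Topology.IsOpenEmbedding i := φ.isOpenEmbedding.comp hj
  have hri : Set.range i = φ '' Set.range j := Set.range_comp φ j
  rw [← hri] at hd
  have hij : ∀ a b, j a ≠ i b := fun a b h =>
    Set.disjoint_left.1 hd ⟨a, rfl⟩ ⟨b, h.symm⟩
  have hqi : q.comp i = q.comp j := by
    ext1 a
    exact involutionMk_apply φ hφ (j a)
  -- Up to homology, `c` is a part in each sheet plus a part `e` that misses both points of the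
  -- fibre.
  obtain ⟨T, T', -, hT', a, ha, b, hb, e, he, hab⟩ := exists_split₃ hj.isOpen_range hi.isOpen_range
    (Set.toFinite {j p, i p}).isClosed.isOpen_compl (c := c) (by
      convert Submodule.mem_top
      rw [← chainsIn_univ]
      congr 1
      rw [Set.eq_univ_iff_forall]
      intro y
      by_cases h : y ∈ ({j p, i p} : Set M)
      · rcases h with rfl | rfl
        · exact Or.inl ⟨p, rfl⟩
        · exact Or.inr (Or.inl ⟨p, rfl⟩)
      · exact Or.inr (Or.inr h))
  obtain ⟨a, rfl⟩ := exists_push_eq hj.isEmbedding ha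
  obtain ⟨b, rfl⟩ := exists_push_eq hi.isEmbedding hb
  have hsum (A : Set M) (hA : e ∈ chainsIn A (m + 1)) :
      Null A (c + (push j a + push i b)) := by
    have e1 : c + (push j a + push i b) = bd (T c) + (T' (bd c) + e) := by
      linear_combination (norm := (abel_nf; simp [two_zsmul_eq_zero])) hab
    rw [e1]
    exact (null_bd _).add (null_of_mem (Submodule.add_mem _
      (chainsIn_mono (Set.empty_subset _) _ (hT' _ _ hc)) hA))
  have hej : e ∈ chainsIn {j p}ᶜ (m + 1) :=
    chainsIn_mono (fun y (hy : y ∉ ({j p, i p} : Set M)) h => hy (Or.inl h)) _ he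
  have hei : e ∈ chainsIn {i p}ᶜ (m + 1) :=
    chainsIn_mono (fun y (hy : y ∉ ({j p, i p} : Set M)) h => hy (Or.inr h)) _ he
  have hbj : push i b ∈ chainsIn {j p}ᶜ (m + 1) := by
    refine chainsIn_mono ?_ _ hb
    rintro _ ⟨z, rfl⟩ h
    exact hij p z h.symm
  have hai : push j a ∈ chainsIn {i p}ᶜ (m + 1) := by
    refine chainsIn_mono ?_ _ ha
    rintro _ ⟨z, rfl⟩ h
    exact hij z p h
  have hcyc {A : Set M} {s t : Chain M (m + 1)} (h : Null A (c + (s + t)))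
      (ht : t ∈ chainsIn A (m + 1)) : RelCycle A s := by
    obtain ⟨d, hd⟩ := h
    have := Submodule.add_mem _ (bd_mem hd)
      (Submodule.add_mem _ (chainsIn_mono (Set.empty_subset A) _ hc) (bd_mem ht))
    rw [RelCycle]
    convert this using 1
    simp only [map_add, bd_bd]
    abel_nf
    simp [two_zsmul_eq_zero]
  have hnj := hsum _ hej
  have hni := hsum _ hei
  rw [add_comm (push j a)] at hni
  have ha_cyc : RelCycle {p}ᶜ a := by
    have := hcyc hnj hbj
    rw [RelCycle, bd_push] at this
    exact chainsIn_mono (fun z (hz : j z ≠ j p) h => hz (congrArg j h)) _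
      (mem_of_push_mem hj.injective this)
  have hb_cyc : RelCycle {p}ᶜ b := by
    have := hcyc hni hai
    rw [RelCycle, bd_push] at this
    exact chainsIn_mono (fun z (hz : i z ≠ i p) h => hz (congrArg i h)) _
      (mem_of_push_mem hi.injective this)
  -- At `j p` only the sheet `j` contributes to `c`, whose local class there is nonzero; likewise
  -- for `i`.
  have ha_n : ¬ Null {p}ᶜ a := fun h => hx (j p) (hnj.of_add
    ((h.map (A := {p}ᶜ) (B := {j p}ᶜ) fun z hz hzp => hz (hj.injective hzp)).add (null_of_mem hbj)))
  have hb_n : ¬ Null {p}ᶜ b := fun h => hx (i p) (hni.of_add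
    ((h.map (A := {p}ᶜ) (B := {i p}ᶜ) fun z hz hzp => hz (hi.injective hzp)).add (null_of_mem hai)))
  -- Two nonzero classes, at most one available: they agree, and their sum vanishes mod 2.
  have hab_n := atMostOneClass_compl_singleton p a b ha_cyc hb_cyc ha_n hb_n
  have hqinj : Set.MapsTo (q.comp j) {p}ᶜ {q (j p)}ᶜ := by
    intro z hz h
    rcases (involutionMk_eq_iff φ hφ).1 h with h | h
    · exact hz (hj.injective h).symm
    · exact hij p z h
  have h2 := hab_n.map hqinj
  have h3 := (hsum ({j p, i p}ᶜ) he).map (B := {q (j p)}ᶜ) (g := q) (by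
    intro z hz h
    rcases (involutionMk_eq_iff φ hφ).1 h.symm with h | h
    · exact hz (Or.inl h)
    · exact hz (Or.inr h))
  rw [map_add, map_add, push_push, push_push, hqi, ← map_add (push (q.comp j))] at h3
  exact h3.of_add h2

/-- A map that is invariant under a free involution kills the fundamental class. -/
theorem exists_push_eq_bd (hφ : ∀ p, φ (φ p) = p)
    (hfree : ∀ p, φ p ≠ p) {m : ℕ} [CompactSpace M] (hM : LocallyEuclidean m M)
    {c : Chain M (m + 1)} (hc : RelCycle ∅ c) (hx : ∀ x, ¬ Null {x}ᶜ c) {S : Type*}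
    [TopologicalSpace S] (g : C(M, S)) (hg : ∀ x, g (φ x) = g x) :
    ∃ d, push g c = bd d := by
  have := t2Space_involutionQuotient φ hφ
  have hN := detected_univ (locallyEuclidean_involutionQuotient hφ hfree hM)
  obtain ⟨d, hd⟩ := hN.null (push (involutionMk φ hφ) c) (by
    rw [RelCycle, bd_push]
    exact push_mem (fun _ h => h.elim) hc) fun y _ => by
      obtain ⟨x, rfl⟩ := Quotient.mk_surjective y
      exact null_push_involutionMk hφ hfree hM hc hx x
  rw [Set.compl_univ] at hd
  let g' : C(InvolutionQuotient φ hφ, S) := ⟨Quotient.lift g (by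
    rintro x y (rfl | rfl)
    · rfl
    · exact (hg x).symm), g.continuous.quotient_lift _⟩
  refine ⟨push g' d, ?_⟩
  rw [bd_push, ← eq_of_add_eq_zero (chainsIn_empty hd), push_push]
  rfl

end Involution

open Opposite Simplicial

section Bridge

variable {X Y : Type u} [TopologicalSpace X] [TopologicalSpace Y]

/-! ### Comparison with the singular chain complex -/

/-- Singular simplices as continuous maps from the standard simplex. -/
abbrev simplexEquiv (X : Type u) [TopologicalSpace X] (k : ℕ) :
    (TopCat.toSSet.obj (TopCat.of X)) _⦋k⦌ ≃ C(Simplex (k + 1), X) :=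
  TopCat.toSSetObjEquiv (TopCat.of X) (op ⦋k⦌)

theorem face_apply {k : ℕ} (i : Fin (k + 1)) (t : Simplex k) :
    face i t = stdSimplex.map i.succAbove t := by
  ext a
  rw [stdSimplex.map_coe, FunOnFinite.linearMap_apply_apply]
  change (∑ j, t.1 j • (Pi.single (i.succAbove j) 1 : Fin (k + 1) → ℝ)) a = _
  rw [Finset.sum_apply, Finset.sum_filter]
  refine Finset.sum_congr rfl fun j _ => ?_
  simp [Pi.single_apply, eq_comm]
  rfl

theorem simplexEquiv_δ {k : ℕ} (i : Fin (k + 2))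
    (x : (TopCat.toSSet.obj (TopCat.of X)) _⦋k + 1⦌) :
    simplexEquiv X k ((TopCat.toSSet.obj (TopCat.of X)).δ i x) =
      (simplexEquiv X (k + 1) x).comp (face i) := by
  ext t
  rw [ContinuousMap.comp_apply, face_apply]
  rfl

theorem simplexEquiv_map (f : C(X, Y)) {k : ℕ} (x : (TopCat.toSSet.obj (TopCat.of X)) _⦋k⦌) :
    simplexEquiv Y k ((TopCat.toSSet.map (TopCat.ofHom f)).app _ x) =
      f.comp (simplexEquiv X k x) := rfl

/-- The inclusion of the summand of a simplex. -/
abbrev simplexInclusion {k : ℕ} (σ : C(Simplex (k + 1), X)) :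
    ModTwo.coeff.{u} ⟶ (ModTwo.chains.obj (TopCat.of X)).X k :=
  SSet.ιChainComplex (TopCat.toSSet.obj (TopCat.of X)) ((simplexEquiv X k).symm σ)

/-- The comparison map to the singular chain complex. -/
def toChains (k : ℕ) :
    Chain X (k + 1) →ₗ[ZMod 2] (ModTwo.chains.obj (TopCat.of X)).X k :=
  Finsupp.linearCombination (ZMod 2) fun σ => (simplexInclusion σ).hom (ULift.up 1)

theorem toChains_single {k : ℕ} (σ : C(Simplex (k + 1), X)) :
    toChains k (Finsupp.single σ 1) = (simplexInclusion σ).hom (ULift.up 1) := by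
  simp [toChains]

theorem coeff_hom_ext {V : ModuleCat.{u} (ZMod 2)} {f g : ModTwo.coeff.{u} ⟶ V}
    (h : f.hom (ULift.up 1) = g.hom (ULift.up 1)) : f = g := by
  ext ⟨a⟩
  have e : (ULift.up a : ULift.{u} (ZMod 2)) = a • ULift.up 1 := by
    ext
    simp
  rw [e, map_smul, map_smul]
  exact congrArg _ h

theorem d_toChains {k : ℕ} (c : Chain X (k + 2)) :
    ((ModTwo.chains.obj (TopCat.of X)).d (k + 1) k).hom (toChains (k + 1) c) =
      toChains k (bd c) := by
  have : ((ModTwo.chains.obj (TopCat.of X)).d (k + 1) k).hom ∘ₗ toChains (k + 1) =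
      toChains k ∘ₗ bd := by
    apply hom_ext_single
    intro σ
    rw [LinearMap.comp_apply, LinearMap.comp_apply, bd_single, map_sum, toChains_single,
      ← LinearMap.comp_apply, ← ModuleCat.hom_comp]
    have h := SSet.ιChainComplex_d _ (R := ModTwo.coeff.{u}) ((simplexEquiv X (k + 1)).symm σ)
    refine (congrArg (fun f => f.hom (ULift.up 1)) h).trans ?_
    rw [ModuleCat.hom_sum, LinearMap.sum_apply]
    refine Finset.sum_congr rfl fun i _ => ?_
    rw [toChains_single, simplexInclusion, ← (simplexEquiv X (k + 1)).apply_symm_apply σ,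
      ← simplexEquiv_δ, Equiv.symm_apply_apply, Equiv.symm_apply_apply]
    -- The alternating signs disappear mod 2.
    rcases neg_one_pow_eq_or ℤ i.1 with h | h
    · rw [h, one_smul]
      rfl
    · rw [h, neg_smul, one_smul, ModuleCat.hom_neg, LinearMap.neg_apply, neg_eq_self]
      rfl
  exact LinearMap.congr_fun this c

theorem map_toChains (f : C(X, Y)) {k : ℕ} (c : Chain X (k + 1)) :
    ((ModTwo.chains.map (TopCat.ofHom f)).f k).hom (toChains k c) = toChains k (push f c) := by
  have : ((ModTwo.chains.map (TopCat.ofHom f)).f k).hom ∘ₗ toChains k =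
      toChains k ∘ₗ push f := by
    apply hom_ext_single
    intro σ
    rw [LinearMap.comp_apply, LinearMap.comp_apply, push_single, toChains_single, toChains_single,
      ← LinearMap.comp_apply, ← ModuleCat.hom_comp]
    have h := SSet.ι_chainComplexMap_f _ _ (f := TopCat.toSSet.map (TopCat.ofHom f))
      (R := ModTwo.coeff.{u}) ((simplexEquiv X k).symm σ)
    refine (congrArg (fun f => f.hom (ULift.up 1)) h).trans ?_
    rw [simplexInclusion, ← (simplexEquiv X k).apply_symm_apply σ, ← simplexEquiv_map,
      Equiv.symm_apply_apply, Equiv.symm_apply_apply]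
    rfl
  exact LinearMap.congr_fun this c

/-- The component of `ofChains` at a simplex. -/
abbrev ofChainsComponent {k : ℕ} (x : (TopCat.toSSet.obj (TopCat.of X)) _⦋k⦌) :
    ModTwo.coeff.{u} ⟶ ModuleCat.of (ZMod 2) (Chain X (k + 1)) :=
  ModuleCat.ofHom ((LinearMap.toSpanSingleton (ZMod 2) (Chain X (k + 1))
    (Finsupp.single (simplexEquiv X k x) 1)) ∘ₗ ULift.moduleEquiv.toLinearMap)

/-- The comparison map from the singular chain complex. -/
def ofChains (k : ℕ) : (ModTwo.chains.obj (TopCat.of X)).X k ⟶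
    ModuleCat.of (ZMod 2) (Chain X (k + 1)) :=
  Limits.Sigma.desc fun x : (TopCat.toSSet.obj (TopCat.of X)) _⦋k⦌ =>
    ofChainsComponent x

theorem simplexInclusion_ofChains {k : ℕ} (σ : C(Simplex (k + 1), X)) :
    (ofChains k).hom ((simplexInclusion σ).hom (ULift.up 1)) = Finsupp.single σ 1 := by
  rw [← LinearMap.comp_apply, ← ModuleCat.hom_comp]
  have h : simplexInclusion σ ≫ ofChains k = ofChainsComponent ((simplexEquiv X k).symm σ) :=
    Limits.Sigma.ι_desc (fun x => ofChainsComponent (X := X) (k := k) x) ((simplexEquiv X k).symm σ)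
  rw [h]
  simp

theorem ofChains_toChains {k : ℕ} (c : Chain X (k + 1)) : (ofChains k).hom (toChains k c) = c := by
  have : (ofChains k).hom ∘ₗ toChains k = LinearMap.id (M := Chain X (k + 1)) := by
    apply hom_ext_single
    intro σ
    rw [LinearMap.comp_apply, toChains_single, simplexInclusion_ofChains]
    rfl
  exact LinearMap.congr_fun this c

theorem toChains_ofChains {k : ℕ} (c : (ModTwo.chains.obj (TopCat.of X)).X k) :
    toChains k ((ofChains k).hom c) = c := by
  have : ofChains k ≫ ModuleCat.ofHom (toChains k) =
      𝟙 ((ModTwo.chains.obj (TopCat.of X)).X k) := by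
    refine SSet.chainComplex_hom_ext fun x => coeff_hom_ext ?_
    obtain ⟨σ, rfl⟩ := (simplexEquiv X k).symm.surjective x
    have := congrArg (toChains k) (simplexInclusion_ofChains σ)
    rw [toChains_single] at this
    refine Eq.trans ?_ (this.trans ?_) <;> rfl
  exact congrArg (fun f => f.hom c) this

/-! ### Homology classes and cycles -/

theorem homologyMap_homologyπ_eq_zero {K L : ChainComplex (ModuleCat.{u} (ZMod 2)) ℕ} (f : K ⟶ L)
    (k : ℕ) (y : K.cycles k) (w : L.X (k + 1))
    (h : (f.f k).hom ((K.iCycles k).hom y) = (L.d (k + 1) k).hom w) :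
    (HomologicalComplex.homologyMap f k).hom ((K.homologyπ k).hom y) = 0 := by
  have e : (HomologicalComplex.cyclesMap f k).hom y = (L.toCycles (k + 1) k).hom w := by
    apply (ModuleCat.mono_iff_injective (L.iCycles k)).1 inferInstance
    have h1 := congrArg (fun g => g.hom y) (HomologicalComplex.cyclesMap_i f k)
    have h2 := congrArg (fun g => g.hom w) (L.toCycles_i (k + 1) k)
    exact h1.trans (h.trans h2.symm)
  have h1 := congrArg (fun g => g.hom y) (HomologicalComplex.homologyπ_naturality f k)
  have h2 := congrArg (fun g => g.hom w) (L.toCycles_comp_homologyπ (k + 1) k)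
  refine h1.trans (Eq.trans ?_ h2)
  exact congrArg (L.homologyπ k).hom e

theorem exists_cycle {k : ℕ} (z : ModTwo.homology k X) :
    ∃ (c : Chain X (k + 1)) (y : (ModTwo.chains.obj (TopCat.of X)).cycles k), RelCycle ∅ c ∧
      ((ModTwo.chains.obj (TopCat.of X)).iCycles k).hom y = toChains k c ∧
      ((ModTwo.chains.obj (TopCat.of X)).homologyπ k).hom y = z := by
  obtain ⟨y, rfl⟩ := (ModuleCat.epi_iff_surjective
    ((ModTwo.chains.obj (TopCat.of X)).homologyπ k)).1 inferInstance z
  refine ⟨(ofChains k).hom (((ModTwo.chains.obj (TopCat.of X)).iCycles k).hom y), y, ?_,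
    (toChains_ofChains _).symm, rfl⟩
  cases k with
  | zero =>
    -- In degree `0` the boundary is carried by the empty simplex, which lies in `∅`.
    intro σ _
    rintro _ ⟨t, _⟩
    simpa using t.2.2
  | succ k =>
    have h : toChains k (bd ((ofChains (k + 1)).hom
        (((ModTwo.chains.obj (TopCat.of X)).iCycles (k + 1)).hom y))) = 0 := by
      rw [← d_toChains, toChains_ofChains]
      exact congrArg (fun g => g.hom y) ((ModTwo.chains.obj (TopCat.of X)).iCycles_d (k + 1) k)
    have h2 := congrArg (ofChains k).hom h
    rw [ofChains_toChains, map_zero] at h2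
    rw [RelCycle, h2]
    exact Submodule.zero_mem _

/-- `c + bd d` comes from `A`, so it dies in the cokernel. The contrapositive turns
`IsFundamentalClass` into `¬ Null {x}ᶜ c`, the only consequence of it that is used. -/
theorem toRelativeHomology_eq_zero {k : ℕ} {A : Set X} {c : Chain X (k + 1)} (hc : Null A c)
    (y : (ModTwo.chains.obj (TopCat.of X)).cycles k)
    (hy : ((ModTwo.chains.obj (TopCat.of X)).iCycles k).hom y = toChains k c) :
    ModTwo.toRelativeHomology k A (((ModTwo.chains.obj (TopCat.of X)).homologyπ k).hom y) = 0 := by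
  obtain ⟨d, hd⟩ := hc
  obtain ⟨e, he⟩ := exists_push_eq (j := (⟨Subtype.val, continuous_subtype_val⟩ : C(A, X)))
    Topology.IsEmbedding.subtypeVal (c := c + bd d) (by
      convert hd
      exact Subtype.range_val)
  set π := Limits.cokernel.π (ModTwo.chainsInclusion A)
  refine homologyMap_homologyπ_eq_zero π k y ((π.f (k + 1)).hom (toChains (k + 1) d)) ?_
  have h1 : (π.f k).hom (toChains k (c + bd d)) = 0 := by
    rw [← he, ← map_toChains]
    have := congrArg (fun g => (g.f k).hom (toChains k e))
      (Limits.cokernel.condition (ModTwo.chainsInclusion A))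
    exact this
  have h2 := congrArg (fun g => g.hom (toChains (k + 1) d)) (π.comm (k + 1) k)
  refine Eq.trans ?_ h2.symm
  change _ = (π.f k).hom (((ModTwo.chains.obj (TopCat.of X)).d (k + 1) k).hom (toChains (k + 1) d))
  rw [d_toChains, hy]
  rw [map_add, map_add] at h1
  exact eq_of_add_eq_zero h1

theorem homologyMap_eq_zero {k : ℕ} (g : C(X, Y)) {c : Chain X (k + 1)} {d : Chain Y (k + 2)}
    (h : push g c = bd d) (y : (ModTwo.chains.obj (TopCat.of X)).cycles k)
    (hy : ((ModTwo.chains.obj (TopCat.of X)).iCycles k).hom y = toChains k c) :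
    ModTwo.homologyMap k g (((ModTwo.chains.obj (TopCat.of X)).homologyπ k).hom y) = 0 := by
  refine homologyMap_homologyπ_eq_zero _ k y (toChains (k + 1) d) ?_
  rw [hy, map_toChains, h, d_toChains]

end Bridge

/-- Let `φ` be a free involution of a closed manifold. A map homotopic to a `φ`-invariant map kills
every fundamental class mod 2. -/
theorem homologyMap_fundamentalClass_eq_zero {m : ℕ} {M S : Type u} [TopologicalSpace M]
    [T2Space M] [CompactSpace M] [TopologicalSpace S] (hM : LocallyEuclidean m M) {φ : M ≃ₜ M}
    (hφ : ∀ p, φ (φ p) = p) (hfree : ∀ p, φ p ≠ p) {r g : C(M, S)} (H : r.Homotopy g)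
    (hg : ∀ x, g (φ x) = g x) {z : ModTwo.homology m M} (hz : ModTwo.IsFundamentalClass m z) :
    ModTwo.homologyMap m r z = 0 := by
  obtain ⟨c, y, hc, hy, rfl⟩ := exists_cycle z
  obtain ⟨d, hd⟩ := exists_push_eq_bd hφ hfree hM hc
    (fun x hx => hz x (toRelativeHomology_eq_zero hx y hy)) g hg
  obtain ⟨e, he⟩ := null_push_add_push (B := ∅) H (fun _ _ h => h.elim) hc
  refine homologyMap_eq_zero r (d := d + e) ?_ y hy
  have h := chainsIn_empty he
  rw [map_add, ← hd]
  rw [add_assoc] at h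
  exact eq_of_add_eq_zero h

end SingularModTwo

end

/-! ### The chord homotopy and the conclusion -/

theorem lemma2p1 (m n : ℕ) {M : Type u} [TopologicalSpace M] [T2Space M] [CompactSpace M]
    [ChartedSpace (EuclideanSpace ℝ (Fin m)) M]
    (φ : M ≃ₜ M) (hφ_free : ∀ p, φ p ≠ p) (hφ_inv : ∀ p, φ (φ p) = p)
    (f : C(M, EuclideanSpace ℝ (Fin n)))
    (L : AffineSubspace ℝ (EuclideanSpace ℝ (Fin n))) [Nonempty L]
    (hL : Module.finrank ℝ L.direction + m + 1 = n)
    (hf : ∀ p, f p ∉ L)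
    (hw : ModTwo.windingNumber m f L hf ≠ 0) :
    ∃ p : M, (segment ℝ (f p) (f (φ p)) ∩ (L : Set (EuclideanSpace ℝ (Fin n)))).Nonempty := by
  by_contra hcon
  push Not at hcon
  obtain ⟨z, hz, hne⟩ : ∃ z : ModTwo.homology m M, ModTwo.IsFundamentalClass m z ∧
      ModTwo.homologyMap m (ModTwo.liftTarget (ModTwo.radialMap f L hf)) z ≠ 0 := by
    by_contra h
    exact hw (if_neg h)
  -- Halving the parameter makes the homotopy stop at the midpoint of the chord.
  have hseg (t : unitInterval) (p : M) :
      (1 - (t : ℝ) / 2) • f p + ((t : ℝ) / 2) • f (φ p) ∉ L := fun h =>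
    (hcon p).subset ⟨⟨1 - (t : ℝ) / 2, (t : ℝ) / 2, by linarith [t.2.2], by linarith [t.2.1],
      by ring, rfl⟩, h⟩
  let F : C(unitInterval × M, EuclideanSpace ℝ (Fin n)) :=
    ⟨fun x => (1 - (x.1 : ℝ) / 2) • f x.2 + ((x.1 : ℝ) / 2) • f (φ x.2), by fun_prop⟩
  let G := ModTwo.liftTarget.{u} (ModTwo.radialMap F L fun x => hseg x.1 x.2)
  -- The radial map depends on a point of `unitInterval × M` only through its image under `F`; this
  -- gives the invariance of the final map, whose midpoints are symmetric in `p` and `φ p`.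
  have hG (a b : unitInterval × M) (h : F a = F b) : G a = G b := by
    refine congrArg ULift.up (Subtype.ext ?_)
    change ‖ModTwo.normalComponent L (F a)‖⁻¹ • ModTwo.normalComponent L (F a) = _
    rw [h]
    rfl
  let H : (ModTwo.liftTarget (ModTwo.radialMap f L hf)).Homotopy
      (G.comp (ContinuousMap.prodMk (ContinuousMap.const M 1) (ContinuousMap.id M))) :=
    { toContinuousMap := G
      map_zero_left := fun p => by
        refine congrArg ULift.up (Subtype.ext ?_)
        change ‖ModTwo.normalComponent L (F (0, p))‖⁻¹ • ModTwo.normalComponent L (F (0, p)) = _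
        have : F (0, p) = f p := by simp [F]
        rw [this]
        rfl
      map_one_left := fun p => rfl }
  refine hne (SingularModTwo.homologyMap_fundamentalClass_eq_zero
    (SingularModTwo.locallyEuclidean_of_chartedSpace m M) hφ_inv hφ_free H (fun p => hG _ _ ?_) hz)
  simp [F, hφ_inv]
  norm_num
  exact add_comm _ _
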